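/- Let $\mathbb F$ be a field and let $q\in\mathbb F$ be nonzero and not a root of unity; put $[3]_q=(q^3-q^{-3})/(q-q^{-1})=q^2+1+q^{-2}$. Let $\mathbb O_q$ be the unital associative $\mathbb F$-algebra (the $S_3$-symmetric $q$-Onsager algebra) with generators $A_i,B_i$ $(i\in\{1,2,3\})$ and relations $$A_iA_j=A_jA_i,\qquad B_iB_j=B_jB_i\qquad(i\ne j),\qquad\qquad A_iB_i=B_iA_i,$$ and, for distinct $i,j\in\{1,2,3\}$, $$A_i^3B_j-[3]_qA_i^2B_jA_i+[3]_qA_iB_jA_i^2-B_jA_i^3=(q^2-q^{-2})^2(B_jA_i-A_iB_j),$$ $$B_j^3A_i-[3]_qB_j^2A_iB_j+[3]_qB_jA_iB_j^2-A_iB_j^3=(q^2-q^{-2})^2(A_iB_j-B_jA_i).$$ Let $\mathrm{Aut}(\mathbb O_q)$ be the group of $\mathbb F$-algebra automorphisms of $\mathbb O_q$ under composition. For each $i\in\{1,2,3\}$ there exist unique $L_i,L_i^*\in\mathrm{Aut}(\mathbb O_q)$ (the Lusztig automorphisms of $\mathbb O_q$ associated with $A_i$ and $B_i$) such that $L_i$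 fixes $A_1,A_2,A_3,B_i$, such that $L_i^*$ fixes $B_1,B_2,B_3,A_i$, and such that for $j\in\{1,2,3\}\setminus\{i\}$ $$L_i(B_j)=B_j+\frac{qA_i^2B_j-(q+q^{-1})A_iB_jA_i+q^{-1}B_jA_i^2}{(q-q^{-1})(q^2-q^{-2})},$$ $$L_i^*(A_j)=A_j+\frac{qB_i^2A_j-(q+q^{-1})B_iA_jB_i+q^{-1}A_jB_i^2}{(q-q^{-1})(q^2-q^{-2})}.$$ They are related as follows. (i) For distinct $i,j\in\{1,2,3\}$: $L_iL_j=L_jL_i$ and $L_i^*L_j^*=L_j^*L_i^*$. (ii) For $i\in\{1,2,3\}$: $L_iL_i^*=L_i^*L_i$. (iii) For distinct $i,j\in\{1,2,3\}$: $L_i^{\pm1},(L_j^*)^{\pm1}$ freely generate a subgroup of $\mathrm{Aut}(\mathbb O_q)$; that is, the homomorphism from the free group on two letters to $\mathrm{Aut}(\mathbb O_q)$ sending the letters to $L_i$ and $L_j^*$ is injective. -/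

import Mathlib

/-- The `q`-integer `[n]_q = (q^n - q^{-n}) / (q - q^{-1})`. -/
def qInt {F : Type*} [Field F] (q : F) (n : ℕ) : F :=
  (q ^ n - q⁻¹ ^ n) / (q - q⁻¹)

/-- Labels of the six standard generators: `Gen.A i` and `Gen.B i`, where
the three indices are the elements of `Fin 3`. -/
inductive Gen : Type
  | A (i : Fin 3) : Gen
  | B (i : Fin 3) : Gen

/-- The left-hand side of the `q`-Dolan/Grady relation (linear in `Y`):
`X^3 Y - [3]_q X^2 Y X + [3]_q X Y X^2 - Y X^3`. -/
def dolanGradyLHS {F R : Type*} [Field F] [Ring R] [Algebra F R] (q : F) (X Y : R) : R :=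
  X ^ 3 * Y - qInt q 3 • (X ^ 2 * Y * X) + qInt q 3 • (X * Y * X ^ 2) - Y * X ^ 3

/-- The right-hand side of the `q`-Dolan/Grady relation: `(q^2 - q^{-2})^2 (Y X - X Y)`. -/
def dolanGradyRHS {F R : Type*} [Field F] [Ring R] [Algebra F R] (q : F) (X Y : R) : R :=
  (q ^ 2 - q⁻¹ ^ 2) ^ 2 • (Y * X - X * Y)

/-- The defining relations of the `S₃`-symmetric `q`-Onsager algebra, on the free algebra
with the six generators. -/
inductive SymOnsagerRel {F : Type*} [Field F] (q : F) :
    FreeAlgebra F Gen → FreeAlgebra F Gen → Prop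
  | comm_AA (i j : Fin 3) (hij : i ≠ j) :
      SymOnsagerRel q (FreeAlgebra.ι F (Gen.A i) * FreeAlgebra.ι F (Gen.A j))
        (FreeAlgebra.ι F (Gen.A j) * FreeAlgebra.ι F (Gen.A i))
  | comm_BB (i j : Fin 3) (hij : i ≠ j) :
      SymOnsagerRel q (FreeAlgebra.ι F (Gen.B i) * FreeAlgebra.ι F (Gen.B j))
        (FreeAlgebra.ι F (Gen.B j) * FreeAlgebra.ι F (Gen.B i))
  | comm_AB (i : Fin 3) :
      SymOnsagerRel q (FreeAlgebra.ι F (Gen.A i) * FreeAlgebra.ι F (Gen.B i))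
        (FreeAlgebra.ι F (Gen.B i) * FreeAlgebra.ι F (Gen.A i))
  | dolanGrady_AB (i j : Fin 3) (hij : i ≠ j) :
      SymOnsagerRel q
        (dolanGradyLHS q (FreeAlgebra.ι F (Gen.A i)) (FreeAlgebra.ι F (Gen.B j)))
        (dolanGradyRHS q (FreeAlgebra.ι F (Gen.A i)) (FreeAlgebra.ι F (Gen.B j)))
  | dolanGrady_BA (i j : Fin 3) (hij : i ≠ j) :
      SymOnsagerRel q
        (dolanGradyLHS q (FreeAlgebra.ι F (Gen.B j)) (FreeAlgebra.ι F (Gen.A i)))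
        (dolanGradyRHS q (FreeAlgebra.ι F (Gen.B j)) (FreeAlgebra.ι F (Gen.A i)))

/-- The `S₃`-symmetric `q`-Onsager algebra `𝕆_q`, by generators and relations. -/
abbrev SymOnsager {F : Type*} [Field F] (q : F) : Type _ :=
  RingQuot (SymOnsagerRel q)

/-- The standard generator `A_i` of `𝕆_q`. -/
def genA {F : Type*} [Field F] (q : F) (i : Fin 3) : SymOnsager q :=
  RingQuot.mkAlgHom F (SymOnsagerRel q) (FreeAlgebra.ι F (Gen.A i))

/-- The standard generator `B_i` of `𝕆_q`. -/
def genB {F : Type*} [Field F] (q : F) (i : Fin 3) : SymOnsager q :=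
  RingQuot.mkAlgHom F (SymOnsagerRel q) (FreeAlgebra.ι F (Gen.B i))

/-- The expression
`Y + (q X^2 Y - (q + q^{-1}) X Y X + q^{-1} Y X^2) / ((q - q^{-1}) (q^2 - q^{-2}))`. -/
def lusztigFormula {F R : Type*} [Field F] [Ring R] [Algebra F R] (q : F) (X Y : R) : R :=
  Y + ((q - q⁻¹) * (q ^ 2 - q⁻¹ ^ 2))⁻¹ •
    (q • (X ^ 2 * Y) - (q + q⁻¹) • (X * Y * X) + q⁻¹ • (Y * X ^ 2))

/-- `L` is the Lusztig automorphism `L_i` of `𝕆_q` associated with `A_i`. -/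
structure IsLusztigA {F : Type*} [Field F] (q : F) (i : Fin 3)
    (L : SymOnsager q ≃ₐ[F] SymOnsager q) : Prop where
  map_A : ∀ j, L (genA q j) = genA q j
  map_B_self : L (genB q i) = genB q i
  map_B : ∀ j, j ≠ i → L (genB q j) = lusztigFormula q (genA q i) (genB q j)

/-- `L` is the Lusztig automorphism `L*_i` of `𝕆_q` associated with `B_i`. -/
structure IsLusztigB {F : Type*} [Field F] (q : F) (i : Fin 3)
    (L : SymOnsager q ≃ₐ[F] SymOnsager q) : Prop where
  map_B : ∀ j, L (genB q j) = genB q j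
  map_A_self : L (genA q i) = genA q i
  map_A : ∀ j, j ≠ i → L (genA q j) = lusztigFormula q (genB q i) (genA q j)

/-! Left and right multiplication by an element A commute, so polynomials in x, y act on the
algebra. The Dolan/Grady relation between A and X says that D(x, y) = `dolanGradyPoly` kills X, and
the Lusztig formula is the action of P(x, y) = `lusztigPoly`. Heuristically, for diagonalizable A
the value P(x, y) at a pair of eigenvalues is a quotient φ(x)/φ(y), so the formula is conjugation by
φ(A). What survives without diagonalizing is a congruence P(x, y)P(y, z) ≡ P₂(x, z) modulo D(x, y)
and D(y, z), and a similar one for three factors. Hence, if X, Y, Z satisfy the relation with A, the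
product of their images is one fixed linear operator applied to XYZ (`lusztigFormula_mul_mul`). The
cubic terms of a Dolan/Grady relation between B and C, with C commuting with A, can be grouped into
such triple products, so the relation passes to the image of B (`DolanGrady.lusztigFormula_left`).
This is the hard part of the existence of L_i; its inverse is the same formula for q⁻¹
(`lusztigFormula_inv`), and L_i^* comes from the symmetry exchanging A and B. Uniqueness and the
commutation rules are then checked on generators.

For freeness, represent the algebra by 2×2 matrices over F(s): A_i becomes a diagonal matrix with
suitable eigenvalues, B_j a conjugate of it, and all other generators become 0. Then L_i and L_j^*
act as conjugation by diag(s, s⁻¹) and by a conjugate of it. These two matrices generate a free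
group, by ping-pong for the valuation at infinity (`injective_lift_diagonalSL_conj`). A word w
acting trivially gives a matrix that commutes with the images of A_i and B_j, hence is ±1; so w² =
1, and w = 1 because free groups have no torsion. -/

/-! ### Polynomial identities behind the Lusztig formula -/

/-- The polynomial `(x - y)(x² - (q² + r²)xy + y² + (q² - r²)²)`; for `r = q⁻¹` this is the
`q`-Dolan/Grady relation, with `x`, `y` acting as left and right multiplication. -/
def dolanGradyPoly {S : Type*} [CommRing S] (q r x y : S) : S :=
  (x - y) * (x ^ 2 - (q ^ 2 + r ^ 2) * x * y + y ^ 2 + (q ^ 2 - r ^ 2) ^ 2)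

/-- The analogue of `dolanGradyPoly` for a product of two elements that satisfy the
`q`-Dolan/Grady relation. -/
def quinticPoly {S : Type*} [CommRing S] (q r x y : S) : S :=
  dolanGradyPoly q r x y * (x ^ 2 - (q ^ 4 + r ^ 4) * x * y + y ^ 2 + (q ^ 4 - r ^ 4) ^ 2)

/-- The Lusztig formula as a polynomial in left and right multiplication; `k` stands for the
inverse of `(q - r)(q² - r²)`. -/
def lusztigPoly {S : Type*} [CommRing S] (q r k x y : S) : S :=
  1 + k * ((x - y) * (q * x - r * y))

/-- The extension of the Lusztig formula to products of two elements. -/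
def lusztigPolyTwo {S : Type*} [CommRing S] (q r k l x y : S) : S :=
  lusztigPoly q r k x y + k * l * (dolanGradyPoly q r x y * (q ^ 2 * x - r ^ 2 * y))

/-- The extension of the Lusztig formula to products of three elements. -/
def lusztigPolyThree {S : Type*} [CommRing S] (q r k l m x y : S) : S :=
  lusztigPolyTwo q r k l x y + k * l * m * (quinticPoly q r x y * (q ^ 3 * x - r ^ 3 * y))

/-- The left cofactor in `lusztigPoly_mul_lusztigPoly`. -/
def lusztigMulCofactorL {S : Type*} [CommRing S] (q r x y z : S) : S :=
    (-q ^ 2) * x +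
    (-q ^ 4 - q ^ 2 - 1) * y +
    (q ^ 4 + q ^ 2 + 1 + r ^ 2) * z

/-- The right cofactor in `lusztigPoly_mul_lusztigPoly`. -/
def lusztigMulCofactorR {S : Type*} [CommRing S] (q r x y z : S) : S :=
    (-q ^ 2 - 1 - r ^ 2 - r ^ 4) * x +
    (1 + r ^ 2 + r ^ 4) * y +
    (r ^ 2) * z

/-- The left cofactor in `quinticPoly_eq`. -/
def quinticCofactorL {S : Type*} [CommRing S] (q r x y z : S) : S :=
    (1) * x ^ 2 +
    (q ^ 2 + 1 + r ^ 2) * x * y +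
    (-q ^ 4 - q ^ 2 - 1 - r ^ 2 - r ^ 4) * x * z +
    (q ^ 4 + q ^ 2 + 2 + r ^ 2 + r ^ 4) * y ^ 2 +
    (-q ^ 6 - 2 * q ^ 4 - 3 * q ^ 2 - 3 - 3 * r ^ 2 - 2 * r ^ 4 - r ^ 6) * y * z +
    (q ^ 6 + q ^ 4 + 2 * q ^ 2 + 2 + 2 * r ^ 2 + r ^ 4 + r ^ 6) * z ^ 2 +
    (q ^ 8 - 2 + r ^ 8)

/-- The right cofactor in `quinticPoly_eq`. -/
def quinticCofactorR {S : Type*} [CommRing S] (q r x y z : S) : S :=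
    (q ^ 6 + q ^ 4 + 2 * q ^ 2 + 2 + 2 * r ^ 2 + r ^ 4 + r ^ 6) * x ^ 2 +
    (-q ^ 6 - 2 * q ^ 4 - 3 * q ^ 2 - 3 - 3 * r ^ 2 - 2 * r ^ 4 - r ^ 6) * x * y +
    (-q ^ 4 - q ^ 2 - 1 - r ^ 2 - r ^ 4) * x * z +
    (q ^ 4 + q ^ 2 + 2 + r ^ 2 + r ^ 4) * y ^ 2 +
    (q ^ 2 + 1 + r ^ 2) * y * z +
    (1) * z ^ 2 +
    (q ^ 8 - 2 + r ^ 8)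

/-- The left cofactor in `lusztigPolyTwo_mul_lusztigPoly`. -/
def seriesMulCofactorL {S : Type*} [CommRing S] (q r x y z : S) : S :=
    (-q ^ 3) * x +
    (-q ^ 7 - q ^ 5 - q ^ 3 - q - r) * y +
    (q ^ 7 + q ^ 5 + q ^ 3 + q + r + r ^ 3) * z

/-- The right cofactor in `lusztigPolyTwo_mul_lusztigPoly`. -/
def seriesMulCofactorR {S : Type*} [CommRing S] (q r x y z : S) : S :=
    (-q ^ 9 - q ^ 7 - 2 * q ^ 5 - 3 * q ^ 3 - 3 * q - 3 * r - 3 * r ^ 3 - 2 * r ^ 5 - r ^ 7 - r ^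
      9) * x ^ 3 +
    (q ^ 9 + 2 * q ^ 7 + 4 * q ^ 5 + 5 * q ^ 3 + 7 * q + 7 * r + 7 * r ^ 3 + 5 * r ^ 5 + 4 * r ^ 7
      + 2 * r ^ 9 + r ^ 11) * x ^ 2 * y +
    (q ^ 7 + q ^ 5 + 2 * q ^ 3 + 2 * q + 3 * r + 2 * r ^ 3 + 2 * r ^ 5 + r ^ 7 + r ^ 9) * x ^ 2 * z
      +
    (-q ^ 7 - 2 * q ^ 5 - 4 * q ^ 3 - 5 * q - 6 * r - 6 * r ^ 3 - 5 * r ^ 5 - 4 * r ^ 7 - 2 * r ^ 9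
      - r ^ 11) * x * y ^ 2 +
    (-q ^ 5 - 2 * q ^ 3 - 3 * q - 3 * r - 3 * r ^ 3 - 3 * r ^ 5 - 2 * r ^ 7 - r ^ 9) * x * y * z +
    (-q ^ 3 - q - r - r ^ 3 - r ^ 5 - r ^ 7) * x * z ^ 2 +
    (q ^ 3 + q + 2 * r + 2 * r ^ 3 + 2 * r ^ 5 + r ^ 7 + r ^ 9) * y ^ 3 +
    (q + r + 2 * r ^ 3 + r ^ 5 + r ^ 7) * y ^ 2 * z +
    (r + r ^ 3 + r ^ 5) * y * z ^ 2 +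
    (r ^ 3) * z ^ 3 +
    (-q ^ 13 - 2 * q ^ 11 - q ^ 9 - 2 * q ^ 7 - q ^ 5 + 3 * q ^ 3 + 2 * q + 3 * r + 4 * r ^ 3 + r ^
      5 - r ^ 9 - 2 * r ^ 11 - 2 * r ^ 13 - r ^ 15) * x +
    (q ^ 11 + q ^ 9 + 2 * q ^ 7 + q ^ 5 - q - 3 * r - 4 * r ^ 3 - 2 * r ^ 5 + 2 * r ^ 11 + 2 * r ^
      13 + r ^ 15) * y +
    (q ^ 9 + q ^ 5 - r - 3 * r ^ 3 + r ^ 11 + r ^ 13) * z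

/-- With x = u + u⁻¹, the zeros y of `dolanGradyPoly` are obtained by scaling u by 1 or q^{±2}. Two
such steps scale by 1, q^{±2} or q^{±4}, which are the zeros of `quinticPoly`; the cofactors certify
membership in the ideal. -/
theorem quinticPoly_eq {F : Type*} [Field F] {q : F} (hq : q ≠ 0) (x y z : F) :
    quinticPoly q q⁻¹ x z =
      quinticCofactorL q q⁻¹ x y z * dolanGradyPoly q q⁻¹ x y +
      quinticCofactorR q q⁻¹ x y z * dolanGradyPoly q q⁻¹ y z := by
  simp only [quinticPoly, dolanGradyPoly, quinticCofactorL, quinticCofactorR]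
  field_simp
  ring

theorem lusztigPoly_mul_lusztigPoly_cleared {F : Type*} [Field F] {q : F} (hq : q ≠ 0) (x y z : F) :
    (q ^ 3 - q⁻¹ ^ 3) * (q ^ 4 - q⁻¹ ^ 4) * (((q - q⁻¹) * (q ^ 2 - q⁻¹ ^ 2) +
      (x - y) * (q * x - q⁻¹ * y)) * ((q - q⁻¹) * (q ^ 2 - q⁻¹ ^ 2) +
      (y - z) * (q * y - q⁻¹ * z))) =
    (q - q⁻¹) * (q ^ 2 - q⁻¹ ^ 2) * ((q ^ 3 - q⁻¹ ^ 3) * (q ^ 4 - q⁻¹ ^ 4) *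
      ((q - q⁻¹) * (q ^ 2 - q⁻¹ ^ 2) + (x - z) * (q * x - q⁻¹ * z)) +
      dolanGradyPoly q q⁻¹ x z * (q ^ 2 * x - q⁻¹ ^ 2 * z) +
      dolanGradyPoly q q⁻¹ x y * lusztigMulCofactorL q q⁻¹ x y z +
      dolanGradyPoly q q⁻¹ y z * lusztigMulCofactorR q q⁻¹ x y z) := by
  simp only [dolanGradyPoly, lusztigMulCofactorL, lusztigMulCofactorR]
  field_simp
  ring

theorem lusztigPolyTwo_mul_lusztigPoly_cleared {F : Type*} [Field F] {q : F} (hq : q ≠ 0) (x y z :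
    F) :
    (q ^ 5 - q⁻¹ ^ 5) * (q ^ 6 - q⁻¹ ^ 6) * (((q ^ 3 - q⁻¹ ^ 3) * (q ^ 4 - q⁻¹ ^ 4) *
      ((q - q⁻¹) * (q ^ 2 - q⁻¹ ^ 2) + (x - y) * (q * x - q⁻¹ * y)) +
      dolanGradyPoly q q⁻¹ x y * (q ^ 2 * x - q⁻¹ ^ 2 * y)) *
      ((q - q⁻¹) * (q ^ 2 - q⁻¹ ^ 2) + (y - z) * (q * y - q⁻¹ * z))) =
    (q - q⁻¹) * (q ^ 2 - q⁻¹ ^ 2) * ((q ^ 5 - q⁻¹ ^ 5) * (q ^ 6 - q⁻¹ ^ 6) *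
      ((q ^ 3 - q⁻¹ ^ 3) * (q ^ 4 - q⁻¹ ^ 4) *
      ((q - q⁻¹) * (q ^ 2 - q⁻¹ ^ 2) + (x - z) * (q * x - q⁻¹ * z)) +
      dolanGradyPoly q q⁻¹ x z * (q ^ 2 * x - q⁻¹ ^ 2 * z)) +
      quinticPoly q q⁻¹ x z * (q ^ 3 * x - q⁻¹ ^ 3 * z) +
      quinticPoly q q⁻¹ x y * seriesMulCofactorL q q⁻¹ x y z +
      dolanGradyPoly q q⁻¹ y z * seriesMulCofactorR q q⁻¹ x y z) := by
  simp only [dolanGradyPoly, quinticPoly, seriesMulCofactorL, seriesMulCofactorR]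
  field_simp
  ring

/-- The cocycle rule for P modulo the two Dolan/Grady polynomials. The correction term in
`lusztigPolyTwo` is a multiple of `dolanGradyPoly`, so it is invisible on a single element that
satisfies the relation. -/
theorem lusztigPoly_mul_lusztigPoly {F : Type*} [Field F] {q k l : F} (hq : q ≠ 0)
    (hk : k * ((q - q⁻¹) * (q ^ 2 - q⁻¹ ^ 2)) = 1)
    (hl : l * ((q ^ 3 - q⁻¹ ^ 3) * (q ^ 4 - q⁻¹ ^ 4)) = 1) (x y z : F) :
    lusztigPoly q q⁻¹ k x y * lusztigPoly q q⁻¹ k y z =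
      lusztigPolyTwo q q⁻¹ k l x z +
        k * l * lusztigMulCofactorL q q⁻¹ x y z * dolanGradyPoly q q⁻¹ x y +
        k * l * lusztigMulCofactorR q q⁻¹ x y z * dolanGradyPoly q q⁻¹ y z := by
  have E := lusztigPoly_mul_lusztigPoly_cleared hq x y z
  unfold lusztigPolyTwo lusztigPoly
  generalize (q - q⁻¹) * (q ^ 2 - q⁻¹ ^ 2) = c at *
  generalize (q ^ 3 - q⁻¹ ^ 3) * (q ^ 4 - q⁻¹ ^ 4) = d at *
  generalize (x - y) * (q * x - q⁻¹ * y) = u at *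
  generalize (y - z) * (q * y - q⁻¹ * z) = v at *
  -- Each 1 is written as `k * c` or `l * d`, so that the denominator-free identity `E` can be
  -- substituted.
  calc _ = (k * c + k * u) * (k * c + k * v) * (l * d) := by rw [hk, hl]; ring
    _ = k * k * l * (d * ((c + u) * (c + v))) := by ring
    _ = k * c * ((k * c) * (l * d) + (l * d) * (k * ((x - z) * (q * x - q⁻¹ * z))) +
          k * l * (dolanGradyPoly q q⁻¹ x z * (q ^ 2 * x - q⁻¹ ^ 2 * z) +
            dolanGradyPoly q q⁻¹ x y * lusztigMulCofactorL q q⁻¹ x y z +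
            dolanGradyPoly q q⁻¹ y z * lusztigMulCofactorR q q⁻¹ x y z)) := by rw [E]; ring
    _ = _ := by rw [hk, hl]; ring

/-- The next step of the cocycle rule. The left factor will act on a product of two elements, which
only `quinticPoly` is known to kill, so the ideal is now generated by the quintic in x, y and
`dolanGradyPoly` in y, z. -/
theorem lusztigPolyTwo_mul_lusztigPoly {F : Type*} [Field F] {q k l m : F} (hq : q ≠ 0)
    (hk : k * ((q - q⁻¹) * (q ^ 2 - q⁻¹ ^ 2)) = 1)
    (hl : l * ((q ^ 3 - q⁻¹ ^ 3) * (q ^ 4 - q⁻¹ ^ 4)) = 1)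
    (hm : m * ((q ^ 5 - q⁻¹ ^ 5) * (q ^ 6 - q⁻¹ ^ 6)) = 1) (x y z : F) :
    lusztigPolyTwo q q⁻¹ k l x y * lusztigPoly q q⁻¹ k y z =
      lusztigPolyThree q q⁻¹ k l m x z +
        k * l * m * seriesMulCofactorL q q⁻¹ x y z * quinticPoly q q⁻¹ x y +
        k * l * m * seriesMulCofactorR q q⁻¹ x y z * dolanGradyPoly q q⁻¹ y z := by
  have E := lusztigPolyTwo_mul_lusztigPoly_cleared hq x y z
  unfold lusztigPolyThree lusztigPolyTwo lusztigPoly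
  generalize (q - q⁻¹) * (q ^ 2 - q⁻¹ ^ 2) = c at *
  generalize (q ^ 3 - q⁻¹ ^ 3) * (q ^ 4 - q⁻¹ ^ 4) = d at *
  generalize (q ^ 5 - q⁻¹ ^ 5) * (q ^ 6 - q⁻¹ ^ 6) = e at *
  generalize (x - y) * (q * x - q⁻¹ * y) = u at *
  generalize (y - z) * (q * y - q⁻¹ * z) = v at *
  generalize (x - z) * (q * x - q⁻¹ * z) = w at *
  generalize dolanGradyPoly q q⁻¹ x y * (q ^ 2 * x - q⁻¹ ^ 2 * y) = t at *
  generalize dolanGradyPoly q q⁻¹ x z * (q ^ 2 * x - q⁻¹ ^ 2 * z) = t' at *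
  calc _ = (((k * c + k * u) * (l * d) + k * l * t) * (k * c + k * v)) * (m * e) := by
        rw [hk, hl, hm]; ring
    _ = k * k * l * m * (e * ((d * (c + u) + t) * (c + v))) := by ring
    _ = k * c * (((k * c) * (l * d) * (m * e) + (l * d) * (m * e) * (k * w)) +
          k * l * (m * e) * t' +
          k * l * m * (quinticPoly q q⁻¹ x z * (q ^ 3 * x - q⁻¹ ^ 3 * z) +
            quinticPoly q q⁻¹ x y * seriesMulCofactorL q q⁻¹ x y z +
            dolanGradyPoly q q⁻¹ y z * seriesMulCofactorR q q⁻¹ x y z)) := by rw [E]; ring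
    _ = _ := by rw [hk, hl, hm]; ring

theorem lusztigPoly_inv_mul_lusztigPoly {F : Type*} [Field F] {q k : F} (hq : q ≠ 0)
    (hk : k * ((q - q⁻¹) * (q ^ 2 - q⁻¹ ^ 2)) = 1) (x y : F) :
    lusztigPoly q⁻¹ q k x y * lusztigPoly q q⁻¹ k x y =
      1 + k ^ 2 * (x - y) * dolanGradyPoly q q⁻¹ x y := by
  have E : ((q - q⁻¹) * (q ^ 2 - q⁻¹ ^ 2) + (x - y) * (q⁻¹ * x - q * y)) *
      ((q - q⁻¹) * (q ^ 2 - q⁻¹ ^ 2) + (x - y) * (q * x - q⁻¹ * y)) =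
      ((q - q⁻¹) * (q ^ 2 - q⁻¹ ^ 2)) ^ 2 + (x - y) * dolanGradyPoly q q⁻¹ x y := by
    unfold dolanGradyPoly
    field_simp
    ring
  unfold lusztigPoly
  generalize (q - q⁻¹) * (q ^ 2 - q⁻¹ ^ 2) = c at *
  calc _ = (k * c + k * ((x - y) * (q⁻¹ * x - q * y))) *
        (k * c + k * ((x - y) * (q * x - q⁻¹ * y))) := by rw [hk]
    _ = k * k * ((c + (x - y) * (q⁻¹ * x - q * y)) * (c + (x - y) * (q * x - q⁻¹ * y))) := by ring
    _ = (k * c) ^ 2 + k ^ 2 * (x - y) * dolanGradyPoly q q⁻¹ x y := by rw [E]; ring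
    _ = _ := by rw [hk]; ring

/-! ### Compatibility of the polynomials with ring homomorphisms -/

section PolynomialMaps

variable {S T : Type*} [CommRing S] [CommRing T] (f : S →+* T) (q r k l m x y z : S)

theorem map_dolanGradyPoly :
    f (dolanGradyPoly q r x y) = dolanGradyPoly (f q) (f r) (f x) (f y) := by
  simp [dolanGradyPoly]

theorem map_quinticPoly : f (quinticPoly q r x y) = quinticPoly (f q) (f r) (f x) (f y) := by
  simp [quinticPoly, map_dolanGradyPoly]

theorem map_lusztigPoly :
    f (lusztigPoly q r k x y) = lusztigPoly (f q) (f r) (f k) (f x) (f y) := by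
  simp [lusztigPoly]

theorem map_lusztigPolyTwo :
    f (lusztigPolyTwo q r k l x y) = lusztigPolyTwo (f q) (f r) (f k) (f l) (f x) (f y) := by
  simp [lusztigPolyTwo, map_dolanGradyPoly, map_lusztigPoly]

theorem map_lusztigPolyThree :
    f (lusztigPolyThree q r k l m x y) =
      lusztigPolyThree (f q) (f r) (f k) (f l) (f m) (f x) (f y) := by
  simp [lusztigPolyThree, map_quinticPoly, map_lusztigPolyTwo]

theorem map_lusztigMulCofactorL : f (lusztigMulCofactorL q r x y z) =
    lusztigMulCofactorL (f q) (f r) (f x) (f y) (f z) := by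
  simp [lusztigMulCofactorL]

theorem map_lusztigMulCofactorR : f (lusztigMulCofactorR q r x y z) =
    lusztigMulCofactorR (f q) (f r) (f x) (f y) (f z) := by
  simp [lusztigMulCofactorR]

theorem map_quinticCofactorL : f (quinticCofactorL q r x y z) =
    quinticCofactorL (f q) (f r) (f x) (f y) (f z) := by
  simp only [quinticCofactorL, map_add, map_sub, map_mul, map_neg, map_pow, map_one, map_ofNat]

theorem map_quinticCofactorR : f (quinticCofactorR q r x y z) =
    quinticCofactorR (f q) (f r) (f x) (f y) (f z) := by
  simp only [quinticCofactorR, map_add, map_sub, map_mul, map_neg, map_pow, map_one, map_ofNat]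

theorem map_seriesMulCofactorL : f (seriesMulCofactorL q r x y z) =
    seriesMulCofactorL (f q) (f r) (f x) (f y) (f z) := by
  simp [seriesMulCofactorL]

theorem map_seriesMulCofactorR : f (seriesMulCofactorR q r x y z) =
    seriesMulCofactorR (f q) (f r) (f x) (f y) (f z) := by
  simp only [seriesMulCofactorR, map_add, map_sub, map_mul, map_neg, map_pow, map_ofNat]

end PolynomialMaps

/-! ### Polynomials acting by left and right multiplication -/

section Sandwich

variable {F R : Type*} [Field F] [Ring R] [Algebra F R]

/-- The action on `X` of a polynomial in left and right multiplication by `A`. -/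
noncomputable def sandwich (A X : R) : MvPolynomial (Fin 2) F →ₗ[F] R :=
  (MvPolynomial.basisMonomials (Fin 2) F).constr F fun m => A ^ m 0 * X * A ^ m 1

/-- The action on the pair `X`, `Y` of a polynomial in multiplication by `A` to the left of `X`,
between `X` and `Y`, and to the right of `Y`. -/
noncomputable def sandwichPair (A X Y : R) : MvPolynomial (Fin 3) F →ₗ[F] R :=
  (MvPolynomial.basisMonomials (Fin 3) F).constr F
    fun m => A ^ m 0 * X * A ^ m 1 * Y * A ^ m 2

theorem sandwich_monomial (A X : R) (m : Fin 2 →₀ ℕ) (c : F) :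
    sandwich A X (MvPolynomial.monomial m c) = c • (A ^ m 0 * X * A ^ m 1) := by
  have h : MvPolynomial.monomial m c = c • MvPolynomial.basisMonomials (Fin 2) F m := by
    simp [MvPolynomial.coe_basisMonomials, MvPolynomial.smul_monomial]
  rw [h, map_smul, sandwich, Module.Basis.constr_basis]

theorem sandwichPair_monomial (A X Y : R) (m : Fin 3 →₀ ℕ) (c : F) :
    sandwichPair A X Y (MvPolynomial.monomial m c) =
      c • (A ^ m 0 * X * A ^ m 1 * Y * A ^ m 2) := by
  have h : MvPolynomial.monomial m c = c • MvPolynomial.basisMonomials (Fin 3) F m := by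
    simp [MvPolynomial.coe_basisMonomials, MvPolynomial.smul_monomial]
  rw [h, map_smul, sandwichPair, Module.Basis.constr_basis]

theorem sandwich_add_left (A X Y : R) (p : MvPolynomial (Fin 2) F) :
    sandwich A (X + Y) p = sandwich A X p + sandwich A Y p := by
  induction p using MvPolynomial.induction_on' with
  | monomial m c => simp [sandwich_monomial, mul_add, add_mul]
  | add p r hp hr => rw [map_add, map_add, map_add, hp, hr]; abel

theorem sandwich_smul_left (A X : R) (a : F) (p : MvPolynomial (Fin 2) F) :
    sandwich A (a • X) p = a • sandwich A X p := by
  induction p using MvPolynomial.induction_on' with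
  | monomial m c => simp [sandwich_monomial, smul_comm a c]
  | add p r hp hr => rw [map_add, map_add, hp, hr, smul_add]

/-- `sandwich` as a linear map in the argument that is acted on. -/
noncomputable def sandwichOp (A : R) (p : MvPolynomial (Fin 2) F) : R →ₗ[F] R where
  toFun X := sandwich A X p
  map_add' X Y := sandwich_add_left A X Y p
  map_smul' a X := sandwich_smul_left A X a p

theorem sandwichOp_apply (A X : R) (p : MvPolynomial (Fin 2) F) :
    sandwichOp A p X = sandwich A X p := rfl

theorem sandwich_mul (A X : R) (p r : MvPolynomial (Fin 2) F) :
    sandwich A X (p * r) = sandwich A (sandwich A X r) p := by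
  induction r using MvPolynomial.induction_on' with
  | add r s hr hs => rw [mul_add, map_add, map_add, sandwich_add_left, hr, hs]
  | monomial n d =>
    induction p using MvPolynomial.induction_on' with
    | add p s hp hs => rw [add_mul, map_add, map_add, hp, hs]
    | monomial m c =>
      rw [MvPolynomial.monomial_mul, sandwich_monomial, sandwich_monomial, sandwich_monomial,
        Finsupp.add_apply, Finsupp.add_apply, pow_add, add_comm (m 1), pow_add]
      simp [mul_assoc, smul_smul]

theorem sandwich_mul_left_of_commute (A X : R) {B : R} (h : Commute A B) (p : MvPolynomial (Fin 2)
    F) :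
    sandwich A (B * X) p = B * sandwich A X p := by
  induction p using MvPolynomial.induction_on' with
  | add r s hr hs => rw [map_add, map_add, mul_add, hr, hs]
  | monomial n d =>
    rw [sandwich_monomial, sandwich_monomial, ← mul_assoc, (h.pow_left (n 0)).eq]
    simp [mul_assoc]

theorem sandwich_mul_right_of_commute (A X : R) {B : R} (h : Commute A B)
    (p : MvPolynomial (Fin 2) F) : sandwich A (X * B) p = sandwich A X p * B := by
  induction p using MvPolynomial.induction_on' with
  | add r s hr hs => rw [map_add, map_add, add_mul, hr, hs]
  | monomial n d =>
    rw [sandwich_monomial, sandwich_monomial, smul_mul_assoc, mul_assoc _ _ B,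
      (h.pow_left (n 1)).eq]
    simp [mul_assoc]

/-- When A and B commute, all four left and right multiplications by them commute. -/
theorem sandwich_comm {A B : R} (h : Commute A B) (X : R) (p r : MvPolynomial (Fin 2) F) :
    sandwich A (sandwich B X r) p = sandwich B (sandwich A X p) r := by
  induction r using MvPolynomial.induction_on' with
  | add r s hr hs => rw [map_add, map_add, sandwich_add_left, hr, hs]
  | monomial n d =>
    rw [sandwich_monomial, sandwich_monomial, sandwich_smul_left,
      sandwich_mul_right_of_commute _ _ (h.pow_right _), sandwich_mul_left_of_commute _ _
        (h.pow_right _)]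

theorem mapDomain_zero_one (n : Fin 2 →₀ ℕ) :
    n.mapDomain (![0, 1] : Fin 2 → Fin 3) 0 = n 0 ∧
    n.mapDomain (![0, 1] : Fin 2 → Fin 3) 1 = n 1 ∧
    n.mapDomain (![0, 1] : Fin 2 → Fin 3) 2 = 0 := by
  have h : Function.Injective (![0, 1] : Fin 2 → Fin 3) := by decide
  exact ⟨Finsupp.mapDomain_apply h n 0, Finsupp.mapDomain_apply h n 1,
    Finsupp.mapDomain_of_notMem_range n 2 (by simp)⟩

theorem mapDomain_one_two (n : Fin 2 →₀ ℕ) :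
    n.mapDomain (![1, 2] : Fin 2 → Fin 3) 0 = 0 ∧
    n.mapDomain (![1, 2] : Fin 2 → Fin 3) 1 = n 0 ∧
    n.mapDomain (![1, 2] : Fin 2 → Fin 3) 2 = n 1 := by
  have h : Function.Injective (![1, 2] : Fin 2 → Fin 3) := by decide
  exact ⟨Finsupp.mapDomain_of_notMem_range n 0 (by simp),
    Finsupp.mapDomain_apply h n 0, Finsupp.mapDomain_apply h n 1⟩

theorem mapDomain_zero_two (n : Fin 2 →₀ ℕ) :
    n.mapDomain (![0, 2] : Fin 2 → Fin 3) 0 = n 0 ∧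
    n.mapDomain (![0, 2] : Fin 2 → Fin 3) 1 = 0 ∧
    n.mapDomain (![0, 2] : Fin 2 → Fin 3) 2 = n 1 := by
  have h : Function.Injective (![0, 2] : Fin 2 → Fin 3) := by decide
  exact ⟨Finsupp.mapDomain_apply h n 0,
    Finsupp.mapDomain_of_notMem_range n 1 (by simp),
    Finsupp.mapDomain_apply h n 1⟩

open MvPolynomial in
-- Without the middle variable nothing is inserted between X and Y, so only their product matters.
theorem sandwichPair_rename_outer (A X Y : R) (p : MvPolynomial (Fin 2) F) :
    sandwichPair A X Y (rename ![0, 2] p) = sandwich A (X * Y) p := by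
  induction p using MvPolynomial.induction_on' with
  | add r s hr hs => rw [map_add, map_add, map_add, hr, hs]
  | monomial n d =>
    obtain ⟨h0, h1, h2⟩ := mapDomain_zero_two n
    rw [rename_monomial, sandwichPair_monomial, sandwich_monomial, h0, h1, h2]
    simp [mul_assoc]

open MvPolynomial in
-- The variables 0 and 1 are the positions on either side of X. Consequently every multiple of a
-- polynomial that kills X acts on the pair as zero.
theorem sandwichPair_mul_rename_left (A X Y : R) (p : MvPolynomial (Fin 3) F)
    (r : MvPolynomial (Fin 2) F) :
    sandwichPair A X Y (p * rename ![0, 1] r) = sandwichPair A (sandwich A X r) Y p := by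
  induction p using MvPolynomial.induction_on' with
  | add p s hp hs => rw [add_mul, map_add, map_add, hp, hs]
  | monomial m c =>
    induction r using MvPolynomial.induction_on' with
    | add r s hr hs =>
      rw [map_add, mul_add, map_add, map_add, hr, hs]
      simp [sandwichPair_monomial, mul_add, add_mul]
    | monomial n d =>
      obtain ⟨h0, h1, h2⟩ := mapDomain_zero_one n
      rw [rename_monomial, monomial_mul, sandwichPair_monomial, sandwich_monomial,
        sandwichPair_monomial, Finsupp.add_apply, Finsupp.add_apply, Finsupp.add_apply, h0, h1, h2,
        pow_add, add_comm (m 1), pow_add]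
      simp [mul_assoc, smul_smul]

open MvPolynomial in
theorem sandwichPair_mul_rename_right (A X Y : R) (p : MvPolynomial (Fin 3) F)
    (r : MvPolynomial (Fin 2) F) :
    sandwichPair A X Y (p * rename ![1, 2] r) = sandwichPair A X (sandwich A Y r) p := by
  induction p using MvPolynomial.induction_on' with
  | add p s hp hs => rw [add_mul, map_add, map_add, hp, hs]
  | monomial m c =>
    induction r using MvPolynomial.induction_on' with
    | add r s hr hs =>
      rw [map_add, mul_add, map_add, map_add, hr, hs]
      simp [sandwichPair_monomial, mul_add, add_mul]
    | monomial n d =>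
      obtain ⟨h0, h1, h2⟩ := mapDomain_one_two n
      rw [rename_monomial, monomial_mul, sandwichPair_monomial, sandwich_monomial,
        sandwichPair_monomial, Finsupp.add_apply, Finsupp.add_apply, Finsupp.add_apply, h0, h1, h2,
        pow_add _ (m 1), add_comm (m 2), pow_add _ (n 1)]
      simp [mul_assoc, smul_smul]

theorem sandwichPair_zero_left (A Y : R) (p : MvPolynomial (Fin 3) F) :
    sandwichPair A 0 Y p = 0 := by
  induction p using MvPolynomial.induction_on' with
  | add p s hp hs => rw [map_add, hp, hs, add_zero]
  | monomial m c => simp [sandwichPair_monomial]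

theorem sandwichPair_zero_right (A X : R) (p : MvPolynomial (Fin 3) F) :
    sandwichPair A X 0 p = 0 := by
  induction p using MvPolynomial.induction_on' with
  | add p s hp hs => rw [map_add, hp, hs, add_zero]
  | monomial m c => simp [sandwichPair_monomial]

theorem sandwichPair_one (A X Y : R) :
    sandwichPair A X Y (1 : MvPolynomial (Fin 3) F) = X * Y := by
  rw [← MvPolynomial.C_1, MvPolynomial.C_apply, sandwichPair_monomial]
  simp

open MvPolynomial in
theorem sandwichPair_rename_mul_rename (A X Y : R) (p r : MvPolynomial (Fin 2) F) :
    sandwichPair A X Y (rename ![0, 1] p * rename ![1, 2] r) =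
      sandwich A X p * sandwich A Y r := by
  rw [sandwichPair_mul_rename_right, ← one_mul (rename ![0, 1] p), sandwichPair_mul_rename_left,
    sandwichPair_one]

theorem sandwich_one (A X : R) : sandwich A X (1 : MvPolynomial (Fin 2) F) = X := by
  rw [← MvPolynomial.C_1, MvPolynomial.C_apply, sandwich_monomial]
  simp

theorem sandwich_C_mul (A X : R) (c : F) (p : MvPolynomial (Fin 2) F) :
    sandwich A X (MvPolynomial.C c * p) = c • sandwich A X p := by
  rw [← MvPolynomial.smul_eq_C_mul, map_smul]

theorem sandwich_X_zero_mul (A X : R) (p : MvPolynomial (Fin 2) F) :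
    sandwich A X (MvPolynomial.X 0 * p) = A * sandwich A X p := by
  rw [sandwich_mul, MvPolynomial.X, sandwich_monomial]
  simp

theorem sandwich_X_one_mul (A X : R) (p : MvPolynomial (Fin 2) F) :
    sandwich A X (MvPolynomial.X 1 * p) = sandwich A X p * A := by
  rw [sandwich_mul, MvPolynomial.X, sandwich_monomial]
  simp

end Sandwich

/-! ### The Lusztig formula: multiplicativity, inverse, preservation of relations -/

section Lusztig

variable {F R : Type*} [Field F] [Ring R] [Algebra F R]

/-- `X` and `Y` satisfy the `q`-Dolan/Grady relation that is linear in `Y`. -/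
def DolanGrady (q : F) (X Y : R) : Prop :=
  dolanGradyLHS q X Y = dolanGradyRHS q X Y

theorem sub_inv_ne_zero_of_pow_ne_one {q : F} (hq0 : q ≠ 0)
    (hq : ∀ n : ℕ, 0 < n → q ^ n ≠ 1) {n : ℕ} (hn : 0 < n) : q ^ n - q⁻¹ ^ n ≠ 0 := by
  intro h
  apply hq (n + n) (by omega)
  rw [sub_eq_zero] at h
  rw [pow_add]
  nth_rewrite 2 [h]
  rw [← mul_pow, mul_inv_cancel₀ hq0, one_pow]

/-- Over an infinite field, polynomial identities may be verified pointwise; this is how the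
identities in F are lifted below. -/
theorem infinite_of_pow_ne_one {q : F} (hq0 : q ≠ 0)
    (hq : ∀ n : ℕ, 0 < n → q ^ n ≠ 1) : Infinite F := by
  refine Infinite.of_injective (fun n : ℕ => q ^ n) ?_
  intro m n h
  simp only at h
  rcases lt_trichotomy m n with hmn | hmn | hmn
  · obtain ⟨k, rfl⟩ := Nat.exists_eq_add_of_lt hmn
    rw [add_assoc, pow_add] at h
    exact absurd (mul_left_cancel₀ (pow_ne_zero m hq0) (h.symm.trans (mul_one _).symm))
      (hq _ (by omega))
  · exact hmn
  · obtain ⟨k, rfl⟩ := Nat.exists_eq_add_of_lt hmn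
    rw [add_assoc, pow_add] at h
    exact absurd (mul_left_cancel₀ (pow_ne_zero n hq0) (h.trans (mul_one _).symm))
      (hq _ (by omega))

theorem qInt_three {q : F} (hq0 : q ≠ 0) (hq1 : q - q⁻¹ ≠ 0) :
    qInt q 3 = q ^ 2 + 1 + q⁻¹ ^ 2 := by
  rw [qInt, div_eq_iff hq1]
  field_simp
  ring

open MvPolynomial in
theorem sandwich_dolanGradyPoly {q : F} (hq0 : q ≠ 0) (hq1 : q - q⁻¹ ≠ 0) (A X : R) :
    sandwich A X (dolanGradyPoly (C q) (C q⁻¹) (MvPolynomial.X 0) (MvPolynomial.X 1)) =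
      dolanGradyLHS q A X - dolanGradyRHS q A X := by
  -- The trailing factors 1 let the lemmas on multiplication by a variable peel every monomial down
  -- to `sandwich_one`.
  have h : dolanGradyPoly (C q) (C q⁻¹) (MvPolynomial.X 0) (MvPolynomial.X 1) =
    MvPolynomial.X 0 * (MvPolynomial.X 0 * (MvPolynomial.X 0 * 1))
     - C (q ^ 2 + 1 + q⁻¹ ^ 2) * (MvPolynomial.X 0 * (MvPolynomial.X 0 * (MvPolynomial.X 1 * 1)))
     + C (q ^ 2 + 1 + q⁻¹ ^ 2) * (MvPolynomial.X 0 * (MvPolynomial.X 1 * (MvPolynomial.X 1 * 1)))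
     - MvPolynomial.X 1 * (MvPolynomial.X 1 * (MvPolynomial.X 1 * 1))
     + C ((q ^ 2 - q⁻¹ ^ 2) ^ 2) * (MvPolynomial.X 0 * 1)
     - C ((q ^ 2 - q⁻¹ ^ 2) ^ 2) * ((MvPolynomial.X 1 : MvPolynomial (Fin 2) F) * 1) := by
    simp only [dolanGradyPoly, map_add, map_sub, map_pow, map_one]
    ring
  rw [h]
  simp only [(sandwich A X).map_add, (sandwich A X).map_sub, sandwich_X_zero_mul,
    sandwich_X_one_mul, sandwich_C_mul,
    sandwich_one, dolanGradyLHS, dolanGradyRHS, qInt_three hq0 hq1, smul_sub, pow_succ, pow_zero,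
    one_mul, mul_assoc]
  abel

open MvPolynomial in
/-- The Lusztig formula as a polynomial in two variables. -/
noncomputable def lusztigMvPoly (q : F) : MvPolynomial (Fin 2) F :=
  lusztigPoly (C q) (C q⁻¹) (C ((q - q⁻¹) * (q ^ 2 - q⁻¹ ^ 2))⁻¹) (MvPolynomial.X 0)
    (MvPolynomial.X 1)

open MvPolynomial in
/-- The extension of the Lusztig formula to products of two elements, as a polynomial in two
variables. -/
noncomputable def lusztigMvPolyTwo (q : F) : MvPolynomial (Fin 2) F :=
  lusztigPolyTwo (C q) (C q⁻¹) (C ((q - q⁻¹) * (q ^ 2 - q⁻¹ ^ 2))⁻¹)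
    (C ((q ^ 3 - q⁻¹ ^ 3) * (q ^ 4 - q⁻¹ ^ 4))⁻¹) (MvPolynomial.X 0) (MvPolynomial.X 1)

open MvPolynomial in
/-- The extension of the Lusztig formula to products of three elements, as a polynomial in two
variables. -/
noncomputable def lusztigMvPolyThree (q : F) : MvPolynomial (Fin 2) F :=
  lusztigPolyThree (C q) (C q⁻¹) (C ((q - q⁻¹) * (q ^ 2 - q⁻¹ ^ 2))⁻¹)
    (C ((q ^ 3 - q⁻¹ ^ 3) * (q ^ 4 - q⁻¹ ^ 4))⁻¹)
    (C ((q ^ 5 - q⁻¹ ^ 5) * (q ^ 6 - q⁻¹ ^ 6))⁻¹) (MvPolynomial.X 0) (MvPolynomial.X 1)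

theorem sandwich_lusztigMvPoly (q : F) (A X : R) :
    sandwich A X (lusztigMvPoly q) = lusztigFormula q A X := by
  have h : lusztigMvPoly q = 1 + MvPolynomial.C ((q - q⁻¹) * (q ^ 2 - q⁻¹ ^ 2))⁻¹ *
     (MvPolynomial.C q * (MvPolynomial.X 0 * (MvPolynomial.X 0 * 1))
     - MvPolynomial.C (q + q⁻¹) * (MvPolynomial.X 0 * (MvPolynomial.X 1 * 1))
     + MvPolynomial.C q⁻¹ * (MvPolynomial.X 1 * (MvPolynomial.X 1 * 1))) := by
    simp only [lusztigMvPoly, lusztigPoly, map_add]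
    ring
  rw [h]
  simp only [(sandwich A X).map_add, (sandwich A X).map_sub, sandwich_X_zero_mul,
    sandwich_X_one_mul, sandwich_C_mul, sandwich_one, lusztigFormula, pow_succ, pow_zero, one_mul,
    mul_assoc]

variable {q : F} (hq0 : q ≠ 0) (hq : ∀ n : ℕ, 0 < n → q ^ n ≠ 1)

include hq0 hq

theorem sandwich_dolanGradyPoly_eq_zero {A X : R} (h : DolanGrady q A X) :
    sandwich A X (dolanGradyPoly (MvPolynomial.C q) (MvPolynomial.C q⁻¹)
      (MvPolynomial.X 0) (MvPolynomial.X 1)) = 0 := by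
  rw [sandwich_dolanGradyPoly hq0 (by
    simpa using sub_inv_ne_zero_of_pow_ne_one hq0 hq one_pos), sub_eq_zero]
  exact h

open MvPolynomial in
-- The two error terms of the cocycle rule kill X and Y respectively. What is left depends on X and
-- Y only through X * Y.
theorem lusztigFormula_mul_lusztigFormula {A X Y : R} (hX : DolanGrady q A X)
    (hY : DolanGrady q A Y) :
    lusztigFormula q A X * lusztigFormula q A Y = sandwich A (X * Y) (lusztigMvPolyTwo q) := by
  have := infinite_of_pow_ne_one hq0 hq
  have hs {n : ℕ} (hn : 0 < n) := sub_inv_ne_zero_of_pow_ne_one hq0 hq hn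
  have hs1 : q - q⁻¹ ≠ 0 := by simpa using hs one_pos
  set k := ((q - q⁻¹) * (q ^ 2 - q⁻¹ ^ 2))⁻¹ with hk
  set l := ((q ^ 3 - q⁻¹ ^ 3) * (q ^ 4 - q⁻¹ ^ 4))⁻¹ with hl
  have key : rename (![0, 1] : Fin 2 → Fin 3) (lusztigMvPoly q) *
      rename ![1, 2] (lusztigMvPoly q) = rename ![0, 2] (lusztigMvPolyTwo q) +
      C k * C l * lusztigMulCofactorL (C q) (C q⁻¹) (MvPolynomial.X 0) (MvPolynomial.X 1)
        (MvPolynomial.X 2) *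
        rename ![0, 1] (dolanGradyPoly (C q) (C q⁻¹) (MvPolynomial.X 0) (MvPolynomial.X 1)) +
      C k * C l * lusztigMulCofactorR (C q) (C q⁻¹) (MvPolynomial.X 0) (MvPolynomial.X 1)
        (MvPolynomial.X 2) *
        rename ![1, 2] (dolanGradyPoly (C q) (C q⁻¹) (MvPolynomial.X 0) (MvPolynomial.X 1)) := by
    apply MvPolynomial.funext
    intro v
    simp only [map_add, map_mul, eval_rename, lusztigMvPoly, lusztigMvPolyTwo, map_lusztigPoly,
      map_lusztigPolyTwo, map_lusztigMulCofactorL, map_lusztigMulCofactorR, map_dolanGradyPoly,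
      eval_C, eval_X, Function.comp_apply]
    exact lusztigPoly_mul_lusztigPoly hq0 (inv_mul_cancel₀ (mul_ne_zero hs1 (hs two_pos)))
      (inv_mul_cancel₀ (mul_ne_zero (hs (by omega)) (hs (by omega)))) _ _ _
  rw [← sandwich_lusztigMvPoly, ← sandwich_lusztigMvPoly, ← sandwichPair_rename_mul_rename, key,
    map_add, map_add, sandwichPair_mul_rename_left, sandwichPair_mul_rename_right,
    sandwichPair_rename_outer, sandwich_dolanGradyPoly_eq_zero hq0 hq hX,
    sandwich_dolanGradyPoly_eq_zero hq0 hq hY, sandwichPair_zero_left, sandwichPair_zero_right,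
    add_zero, add_zero]

open MvPolynomial in
theorem sandwich_mul_quinticPoly {A X Y : R} (hX : DolanGrady q A X) (hY : DolanGrady q A Y) :
    sandwich A (X * Y) (quinticPoly (C q) (C q⁻¹) (MvPolynomial.X 0) (MvPolynomial.X 1)) = 0 := by
  have := infinite_of_pow_ne_one hq0 hq
  have key : rename (![0, 2] : Fin 2 → Fin 3) (quinticPoly (C q) (C q⁻¹) (MvPolynomial.X 0)
    (MvPolynomial.X 1)) =
      quinticCofactorL (C q) (C q⁻¹) (MvPolynomial.X 0) (MvPolynomial.X 1) (MvPolynomial.X 2) *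
        rename ![0, 1] (dolanGradyPoly (C q) (C q⁻¹) (MvPolynomial.X 0) (MvPolynomial.X 1)) +
      quinticCofactorR (C q) (C q⁻¹) (MvPolynomial.X 0) (MvPolynomial.X 1) (MvPolynomial.X 2) *
        rename ![1, 2] (dolanGradyPoly (C q) (C q⁻¹) (MvPolynomial.X 0) (MvPolynomial.X 1)) := by
    apply MvPolynomial.funext
    intro v
    simp only [map_add, map_mul, eval_rename, map_quinticPoly,
      map_quinticCofactorL, map_quinticCofactorR, map_dolanGradyPoly,
      eval_C, eval_X, Function.comp_apply]
    exact quinticPoly_eq hq0 _ _ _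
  rw [← sandwichPair_rename_outer, key,
    map_add, sandwichPair_mul_rename_left, sandwichPair_mul_rename_right,
    sandwich_dolanGradyPoly_eq_zero hq0 hq hX,
    sandwich_dolanGradyPoly_eq_zero hq0 hq hY, sandwichPair_zero_left, sandwichPair_zero_right,
    add_zero]

open MvPolynomial in
theorem sandwich_lusztigMvPolyTwo_mul_lusztigFormula {A W Y : R}
    (hW : sandwich A W (quinticPoly (C q) (C q⁻¹) (MvPolynomial.X 0) (MvPolynomial.X 1)) = 0)
    (hY : DolanGrady q A Y) :
    sandwich A W (lusztigMvPolyTwo q) * lusztigFormula q A Y =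
      sandwich A (W * Y) (lusztigMvPolyThree q) := by
  have := infinite_of_pow_ne_one hq0 hq
  have hs {n : ℕ} (hn : 0 < n) := sub_inv_ne_zero_of_pow_ne_one hq0 hq hn
  have hs1 : q - q⁻¹ ≠ 0 := by simpa using hs one_pos
  set k := ((q - q⁻¹) * (q ^ 2 - q⁻¹ ^ 2))⁻¹ with hk
  set l := ((q ^ 3 - q⁻¹ ^ 3) * (q ^ 4 - q⁻¹ ^ 4))⁻¹ with hl
  set m := ((q ^ 5 - q⁻¹ ^ 5) * (q ^ 6 - q⁻¹ ^ 6))⁻¹ with hm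
  have key : rename (![0, 1] : Fin 2 → Fin 3) (lusztigMvPolyTwo q) *
      rename ![1, 2] (lusztigMvPoly q) = rename ![0, 2] (lusztigMvPolyThree q) +
      C k * C l * C m * seriesMulCofactorL (C q) (C q⁻¹) (MvPolynomial.X 0) (MvPolynomial.X 1)
        (MvPolynomial.X 2) *
        rename ![0, 1] (quinticPoly (C q) (C q⁻¹) (MvPolynomial.X 0) (MvPolynomial.X 1)) +
      C k * C l * C m * seriesMulCofactorR (C q) (C q⁻¹) (MvPolynomial.X 0) (MvPolynomial.X 1)
        (MvPolynomial.X 2) *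
        rename ![1, 2] (dolanGradyPoly (C q) (C q⁻¹) (MvPolynomial.X 0) (MvPolynomial.X 1)) := by
    apply MvPolynomial.funext
    intro v
    simp only [map_add, map_mul, eval_rename, lusztigMvPoly, lusztigMvPolyTwo,
      lusztigMvPolyThree, map_lusztigPoly, map_lusztigPolyTwo, map_lusztigPolyThree,
      map_seriesMulCofactorL, map_seriesMulCofactorR, map_dolanGradyPoly, map_quinticPoly,
      eval_C, eval_X, Function.comp_apply]
    exact lusztigPolyTwo_mul_lusztigPoly hq0 (inv_mul_cancel₀ (mul_ne_zero hs1 (hs two_pos)))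
      (inv_mul_cancel₀ (mul_ne_zero (hs (by omega)) (hs (by omega))))
      (inv_mul_cancel₀ (mul_ne_zero (hs (by omega)) (hs (by omega)))) _ _ _
  rw [← sandwich_lusztigMvPoly, ← sandwichPair_rename_mul_rename, key,
    map_add, map_add, sandwichPair_mul_rename_left, sandwichPair_mul_rename_right,
    sandwichPair_rename_outer, hW,
    sandwich_dolanGradyPoly_eq_zero hq0 hq hY, sandwichPair_zero_left, sandwichPair_zero_right,
    add_zero, add_zero]

omit hq0 hq in
theorem lusztigFormula_one (A : R) : lusztigFormula q A 1 = 1 := by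
  simp only [lusztigFormula, mul_one, one_mul, ← sq, add_smul]
  simp

omit hq0 hq in
theorem dolanGrady_one (A : R) : DolanGrady q A 1 := by
  simp only [DolanGrady, dolanGradyLHS, dolanGradyRHS, mul_one, one_mul, ← pow_succ, ← pow_succ']
  simp

theorem lusztigFormula_mul_mul {A X Y Z : R} (hX : DolanGrady q A X)
    (hY : DolanGrady q A Y) (hZ : DolanGrady q A Z) :
    lusztigFormula q A X * lusztigFormula q A Y * lusztigFormula q A Z =
      sandwichOp A (lusztigMvPolyThree q) (X * Y * Z) := by
  rw [lusztigFormula_mul_lusztigFormula hq0 hq hX hY,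
    sandwich_lusztigMvPolyTwo_mul_lusztigFormula hq0 hq
      (sandwich_mul_quinticPoly hq0 hq hX hY) hZ, sandwichOp_apply]

/-- The element 1 satisfies the relation and is fixed by the formula, so a single element can be
padded to a triple product. -/
theorem sandwichOp_lusztigMvPolyThree {A X : R} (hX : DolanGrady q A X) :
    sandwichOp A (lusztigMvPolyThree q) X = lusztigFormula q A X := by
  have := lusztigFormula_mul_mul hq0 hq hX (dolanGrady_one A) (dolanGrady_one A)
  simpa [lusztigFormula_one] using this.symm

theorem lusztigFormula_commute {A X Y : R} (hX : DolanGrady q A X) (hY : DolanGrady q A Y)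
    (h : X * Y = Y * X) :
    lusztigFormula q A X * lusztigFormula q A Y = lusztigFormula q A Y * lusztigFormula q A X := by
  rw [lusztigFormula_mul_lusztigFormula hq0 hq hX hY,
    lusztigFormula_mul_lusztigFormula hq0 hq hY hX, h]

/-- The product of the polynomials for q⁻¹ and q is 1 plus a multiple of `dolanGradyPoly`, which
kills X. -/
theorem lusztigFormula_inv {A X : R} (hX : DolanGrady q A X) :
    lusztigFormula q⁻¹ A (lusztigFormula q A X) = X := by
  have := infinite_of_pow_ne_one hq0 hq
  have hs {n : ℕ} (hn : 0 < n) := sub_inv_ne_zero_of_pow_ne_one hq0 hq hn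
  have hs1 : q - q⁻¹ ≠ 0 := by simpa using hs one_pos
  have hc : (q⁻¹ - q) * (q⁻¹ ^ 2 - q ^ 2) = (q - q⁻¹) * (q ^ 2 - q⁻¹ ^ 2) := by ring
  have key : lusztigMvPoly q⁻¹ * lusztigMvPoly q = 1 +
      (MvPolynomial.C ((q - q⁻¹) * (q ^ 2 - q⁻¹ ^ 2))⁻¹) ^ 2 *
        (MvPolynomial.X 0 - MvPolynomial.X 1) *
        dolanGradyPoly (MvPolynomial.C q) (MvPolynomial.C q⁻¹) (MvPolynomial.X 0)
          (MvPolynomial.X 1) := by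
    apply MvPolynomial.funext
    intro v
    simp only [map_add, map_mul, map_sub, map_pow, map_one, lusztigMvPoly, map_lusztigPoly,
      map_dolanGradyPoly, MvPolynomial.eval_C, MvPolynomial.eval_X, inv_inv, hc]
    exact lusztigPoly_inv_mul_lusztigPoly hq0
      (inv_mul_cancel₀ (mul_ne_zero hs1 (hs two_pos))) _ _
  rw [← sandwich_lusztigMvPoly, ← sandwich_lusztigMvPoly, ← sandwich_mul, key, map_add,
    sandwich_one, sandwich_mul, sandwich_dolanGradyPoly_eq_zero hq0 hq hX, ← sandwichOp_apply,
    map_zero, add_zero]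

omit hq0 hq in
theorem sandwich_mem_of_commute {A B : R} (h : Commute A B) {X : R} (hX : Commute X B)
    (p : MvPolynomial (Fin 2) F) : Commute (sandwich A X p) B := by
  rw [Commute, SemiconjBy, ← sandwich_mul_right_of_commute _ _ h, hX.eq,
    sandwich_mul_left_of_commute _ _ h]

omit hq0 hq in
theorem lusztigFormula_commute_of_commute {A B X : R} (h : Commute A B) (hX : Commute X B) :
    Commute (lusztigFormula q A X) B := by
  rw [← sandwich_lusztigMvPoly]
  exact sandwich_mem_of_commute h hX _

omit hq0 hq in
theorem lusztigFormula_comm (q' : F) {A B : R} (h : Commute A B) (X : R) :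
    lusztigFormula q A (lusztigFormula q' B X) = lusztigFormula q' B (lusztigFormula q A X) := by
  simp only [← sandwich_lusztigMvPoly]
  exact sandwich_comm h _ _ _

theorem dolanGrady_iff {A X : R} : DolanGrady q A X ↔
    sandwich A X (dolanGradyPoly (MvPolynomial.C q) (MvPolynomial.C q⁻¹)
      (MvPolynomial.X 0) (MvPolynomial.X 1)) = 0 := by
  rw [sandwich_dolanGradyPoly hq0 (by
    simpa using sub_inv_ne_zero_of_pow_ne_one hq0 hq one_pos), sub_eq_zero]
  rfl

theorem DolanGrady.lusztigFormula_right {A B X : R} (h : Commute A B) (hX : DolanGrady q B X) :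
    DolanGrady q B (lusztigFormula q A X) := by
  rw [dolanGrady_iff hq0 hq] at hX ⊢
  rw [← sandwich_lusztigMvPoly, sandwich_comm h.symm, hX, ← sandwichOp_apply, map_zero]

theorem DolanGrady.mul_right {A X C : R} (h : Commute A C) (hX : DolanGrady q A X) :
    DolanGrady q A (X * C) := by
  rw [dolanGrady_iff hq0 hq] at hX ⊢
  rw [sandwich_mul_right_of_commute _ _ h, hX, zero_mul]

theorem DolanGrady.mul_left {A X C : R} (h : Commute A C) (hX : DolanGrady q A X) :
    DolanGrady q A (C * X) := by
  rw [dolanGrady_iff hq0 hq] at hX ⊢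
  rw [sandwich_mul_left_of_commute _ _ h, hX, mul_zero]

/-- Since A commutes with C, both B * C and C * B satisfy the relation with A, and the formula
passes through the factor C. One linear operator then sends every term of the relation between B and
C to the same term with B replaced by its image. -/
theorem DolanGrady.lusztigFormula_left {A B C : R} (h : Commute A C) (hB : DolanGrady q A B)
    (hBC : DolanGrady q B C) : DolanGrady q (lusztigFormula q A B) C := by
  have hr := DolanGrady.mul_right hq0 hq h hB
  have hl := DolanGrady.mul_left hq0 hq h hB
  have er : lusztigFormula q A (B * C) = lusztigFormula q A B * C := by
    rw [← sandwich_lusztigMvPoly, sandwich_mul_right_of_commute _ _ h, sandwich_lusztigMvPoly]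
  have el : lusztigFormula q A (C * B) = C * lusztigFormula q A B := by
    rw [← sandwich_lusztigMvPoly, sandwich_mul_left_of_commute _ _ h, sandwich_lusztigMvPoly]
  -- The four cubic terms are B·B·(BC), B·B·(CB), B·(CB)·B and (CB)·B·B, each a product of three
  -- elements to which multiplicativity applies. The terms BC and CB on the right-hand side are
  -- covered by `f1` and `f0`.
  have e3 := lusztigFormula_mul_mul hq0 hq hB hB hr
  have e2 := lusztigFormula_mul_mul hq0 hq hB hB hl
  have e1 := lusztigFormula_mul_mul hq0 hq hB hl hB
  have e0 := lusztigFormula_mul_mul hq0 hq hl hB hB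
  rw [er] at e3
  rw [el] at e2 e1 e0
  have f1 := sandwichOp_lusztigMvPolyThree hq0 hq hr
  have f0 := sandwichOp_lusztigMvPolyThree hq0 hq hl
  rw [er] at f1
  rw [el] at f0
  unfold DolanGrady dolanGradyLHS dolanGradyRHS at hBC ⊢
  have key := congrArg (sandwichOp A (lusztigMvPolyThree q)) hBC
  simp only [map_add, map_sub, map_smul, pow_succ, pow_zero, one_mul] at key
  simp only [pow_succ, pow_zero, one_mul]
  simp only [mul_assoc] at e0 e1 e2 e3 f0 f1 key ⊢
  rw [e0, e1, e2, e3, ← f0, ← f1]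
  exact key

end Lusztig

/-! ### Construction of the Lusztig automorphisms and their commutation -/

section Automorphisms

variable {F R : Type*} [Field F] [Ring R] [Algebra F R]

theorem dolanGrady_inv_iff {q : F} {X Y : R} : DolanGrady q⁻¹ X Y ↔ DolanGrady q X Y := by
  have h3 : qInt q⁻¹ 3 = qInt q 3 := by
    simp only [qInt, inv_inv]
    rw [← neg_sub (q ^ 3), ← neg_sub q, neg_div_neg_eq]
  simp only [DolanGrady, dolanGradyLHS, dolanGradyRHS, h3, inv_inv]
  rw [← neg_sub (q ^ 2), neg_sq]

theorem map_lusztigFormula {S : Type*} [Ring S] [Algebra F S] (f : R →ₐ[F] S) (q : F) (X Y : R) :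
    f (lusztigFormula q X Y) = lusztigFormula q (f X) (f Y) := by
  simp [lusztigFormula]

theorem DolanGrady.map {S : Type*} [Ring S] [Algebra F S] (f : R →ₐ[F] S) {q : F} {X Y : R}
    (h : DolanGrady q X Y) : DolanGrady q (f X) (f Y) := by
  simpa [DolanGrady, dolanGradyLHS, dolanGradyRHS] using congrArg f h

/-- The elements `a i`, `b i` satisfy the defining relations of `𝕆_q`. -/
structure OnsagerFamily (q : F) (a b : Fin 3 → R) : Prop where
  comm_left : ∀ i j, Commute (a i) (a j)
  comm_right : ∀ i j, Commute (b i) (b j)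
  comm_self : ∀ i, Commute (a i) (b i)
  dolanGrady_left : ∀ i j, i ≠ j → DolanGrady q (a i) (b j)
  dolanGrady_right : ∀ i j, i ≠ j → DolanGrady q (b i) (a j)

namespace OnsagerFamily

variable {q : F} {a b : Fin 3 → R}

theorem symm (h : OnsagerFamily q a b) : OnsagerFamily q b a where
  comm_left := h.comm_right
  comm_right := h.comm_left
  comm_self i := (h.comm_self i).symm
  dolanGrady_left := h.dolanGrady_right
  dolanGrady_right := h.dolanGrady_left

theorem inv (h : OnsagerFamily q a b) : OnsagerFamily q⁻¹ a b where
  comm_left := h.comm_left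
  comm_right := h.comm_right
  comm_self := h.comm_self
  dolanGrady_left i j hij := dolanGrady_inv_iff.2 (h.dolanGrady_left i j hij)
  dolanGrady_right i j hij := dolanGrady_inv_iff.2 (h.dolanGrady_right i j hij)

theorem of_inv (h : OnsagerFamily q⁻¹ a b) : OnsagerFamily q a b := by
  simpa using h.inv

/-- The images of the generators `B_j` under the Lusztig automorphism associated with `A_i`. -/
def lusztig (q : F) (a b : Fin 3 → R) (i j : Fin 3) : R :=
  if j = i then b i else lusztigFormula q (a i) (b j)

theorem lusztig_self (q : F) (a b : Fin 3 → R) (i : Fin 3) : lusztig q a b i i = b i :=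
  if_pos rfl

theorem lusztig_of_ne (q : F) (a b : Fin 3 → R) {i j : Fin 3} (h : j ≠ i) :
    lusztig q a b i j = lusztigFormula q (a i) (b j) :=
  if_neg h

/-- The new `b` commute among themselves by multiplicativity. The relations linear in the new `b`
survive because the `a` commute, and those cubic in the new `b` are
`DolanGrady.lusztigFormula_left`. -/
theorem lusztig_family (hq0 : q ≠ 0) (hq : ∀ n : ℕ, 0 < n → q ^ n ≠ 1)
    (h : OnsagerFamily q a b) (i : Fin 3) : OnsagerFamily q a (lusztig q a b i) where
  comm_left := h.comm_left
  comm_right j k := by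
    rcases eq_or_ne j i with rfl | hj <;> rcases eq_or_ne k j with rfl | hk
    · exact Commute.refl _
    · rw [lusztig_self, lusztig_of_ne _ _ _ hk]
      exact (lusztigFormula_commute_of_commute (h.comm_self j) (h.comm_right k j)).symm
    · exact Commute.refl _
    · rw [lusztig_of_ne _ _ _ hj]
      rcases eq_or_ne k i with rfl | hki
      · rw [lusztig_self]
        exact lusztigFormula_commute_of_commute (h.comm_self k) (h.comm_right j k)
      · rw [lusztig_of_ne _ _ _ hki]
        exact lusztigFormula_commute hq0 hq (h.dolanGrady_left _ _ hj.symm)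
          (h.dolanGrady_left _ _ hki.symm) (h.comm_right j k)
  comm_self j := by
    rcases eq_or_ne j i with rfl | hj
    · rw [lusztig_self]
      exact h.comm_self j
    · rw [lusztig_of_ne _ _ _ hj]
      exact (lusztigFormula_commute_of_commute (h.comm_left i j) (h.comm_self j).symm).symm
  dolanGrady_left j k hjk := by
    rcases eq_or_ne k i with rfl | hk
    · rw [lusztig_self]
      exact h.dolanGrady_left _ _ hjk
    · rw [lusztig_of_ne _ _ _ hk]
      exact DolanGrady.lusztigFormula_right hq0 hq (h.comm_left i j) (h.dolanGrady_left _ _ hjk)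
  dolanGrady_right j k hjk := by
    rcases eq_or_ne j i with rfl | hj
    · rw [lusztig_self]
      exact h.dolanGrady_right _ _ hjk
    · rw [lusztig_of_ne _ _ _ hj]
      exact DolanGrady.lusztigFormula_left hq0 hq (h.comm_left i k)
        (h.dolanGrady_left _ _ hj.symm) (h.dolanGrady_right _ _ hjk)

/-- The algebra homomorphism from `𝕆_q` given by the images of the generators. -/
noncomputable def lift (h : OnsagerFamily q a b) : SymOnsager q →ₐ[F] R :=
  RingQuot.liftAlgHom F ⟨FreeAlgebra.lift F (fun g => Gen.casesOn g a b), by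
    intro x y hxy
    cases hxy with
    | comm_AA i j hij => simpa using (h.comm_left i j).eq
    | comm_BB i j hij => simpa using (h.comm_right i j).eq
    | comm_AB i => simpa using (h.comm_self i).eq
    | dolanGrady_AB i j hij =>
      simpa [DolanGrady, dolanGradyLHS, dolanGradyRHS] using h.dolanGrady_left i j hij
    | dolanGrady_BA i j hij =>
      simpa [DolanGrady, dolanGradyLHS, dolanGradyRHS] using h.dolanGrady_right j i hij.symm⟩

theorem lift_genA (h : OnsagerFamily q a b) (i : Fin 3) : h.lift (genA q i) = a i := by
  simp [lift, genA]

theorem lift_genB (h : OnsagerFamily q a b) (i : Fin 3) : h.lift (genB q i) = b i := by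
  simp [lift, genB]

end OnsagerFamily

theorem SymOnsager.algHom_ext {q : F} {f g : SymOnsager q →ₐ[F] R}
    (hA : ∀ i, f (genA q i) = g (genA q i)) (hB : ∀ i, f (genB q i) = g (genB q i)) : f = g := by
  apply RingQuot.ringQuot_ext' F
  apply FreeAlgebra.hom_ext
  funext x
  cases x with
  | A i => exact hA i
  | B i => exact hB i

theorem SymOnsager.algEquiv_ext {q : F} {f g : SymOnsager q ≃ₐ[F] SymOnsager q}
    (hA : ∀ i, f (genA q i) = g (genA q i)) (hB : ∀ i, f (genB q i) = g (genB q i)) : f = g :=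
  AlgEquiv.coe_toAlgHom_injective (SymOnsager.algHom_ext hA hB)

theorem onsagerFamily_gen (q : F) : OnsagerFamily q (genA q) (genB q) where
  comm_left i j := by
    rcases eq_or_ne i j with rfl | h
    · exact Commute.refl _
    · simpa [Commute, SemiconjBy, genA, genB] using
        RingQuot.mkAlgHom_rel F (SymOnsagerRel.comm_AA (q := q) i j h)
  comm_right i j := by
    rcases eq_or_ne i j with rfl | h
    · exact Commute.refl _
    · simpa [Commute, SemiconjBy, genA, genB] using
        RingQuot.mkAlgHom_rel F (SymOnsagerRel.comm_BB (q := q) i j h)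
  comm_self i := by simpa [Commute, SemiconjBy, genA, genB] using
        RingQuot.mkAlgHom_rel F (SymOnsagerRel.comm_AB (q := q) i)
  dolanGrady_left i j h := by
    simpa [DolanGrady, dolanGradyLHS, dolanGradyRHS, genA, genB] using
      RingQuot.mkAlgHom_rel F (SymOnsagerRel.dolanGrady_AB (q := q) i j h)
  dolanGrady_right i j h := by
    simpa [DolanGrady, dolanGradyLHS, dolanGradyRHS, genA, genB] using
      RingQuot.mkAlgHom_rel F (SymOnsagerRel.dolanGrady_BA (q := q) j i h.symm)

variable {q : F} (hq0 : q ≠ 0) (hq : ∀ n : ℕ, 0 < n → q ^ n ≠ 1)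

include hq in
theorem inv_pow_ne_one (n : ℕ) (hn : 0 < n) : q⁻¹ ^ n ≠ 1 := by
  rw [inv_pow, ne_eq, inv_eq_one]
  exact hq n hn

include hq0 hq

theorem exists_isLusztigA (i : Fin 3) :
    ∃ L : SymOnsager q ≃ₐ[F] SymOnsager q, IsLusztigA q i L := by
  have h := onsagerFamily_gen q
  have h1 := h.lusztig_family hq0 hq i
  -- The relations are invariant under q ↦ q⁻¹, so the formula for q⁻¹ also defines an endomorphism;
  -- it is the inverse.
  have h2 := (h.inv.lusztig_family (inv_ne_zero hq0) (inv_pow_ne_one hq) i).of_inv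
  refine ⟨AlgEquiv.ofAlgHom h1.lift h2.lift ?_ ?_, ?_, ?_, ?_⟩
  · apply SymOnsager.algHom_ext
    · simp [OnsagerFamily.lift_genA]
    · intro j
      rcases eq_or_ne j i with rfl | hj
      · simp [OnsagerFamily.lift_genB, OnsagerFamily.lusztig_self]
      · simp only [AlgHom.comp_apply, OnsagerFamily.lift_genB, OnsagerFamily.lusztig_of_ne _ _ _ hj,
          map_lusztigFormula, OnsagerFamily.lift_genA, AlgHom.id_apply]
        exact lusztigFormula_inv hq0 hq (h.dolanGrady_left _ _ hj.symm)
  · apply SymOnsager.algHom_ext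
    · simp [OnsagerFamily.lift_genA]
    · intro j
      rcases eq_or_ne j i with rfl | hj
      · simp [OnsagerFamily.lift_genB, OnsagerFamily.lusztig_self]
      · simp only [AlgHom.comp_apply, OnsagerFamily.lift_genB, OnsagerFamily.lusztig_of_ne _ _ _ hj,
          map_lusztigFormula, OnsagerFamily.lift_genA, AlgHom.id_apply]
        simpa using lusztigFormula_inv (inv_ne_zero hq0) (inv_pow_ne_one hq)
          (h.inv.dolanGrady_left _ _ hj.symm)
  · simp [OnsagerFamily.lift_genA]
  · simp [OnsagerFamily.lift_genB, OnsagerFamily.lusztig_self]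
  · intro j hj
    simp [OnsagerFamily.lift_genB, OnsagerFamily.lusztig_of_ne _ _ _ hj]

omit hq0 hq in
variable (q) in
/-- The automorphism of `𝕆_q` that swaps `A_i` and `B_i`. -/
noncomputable def swapEquiv : SymOnsager q ≃ₐ[F] SymOnsager q :=
  have h : (onsagerFamily_gen q).symm.lift.comp (onsagerFamily_gen q).symm.lift =
      AlgHom.id F _ := by
    apply SymOnsager.algHom_ext <;> simp [OnsagerFamily.lift_genA, OnsagerFamily.lift_genB]
  AlgEquiv.ofAlgHom (onsagerFamily_gen q).symm.lift (onsagerFamily_gen q).symm.lift h h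

omit hq0 hq in
theorem swapEquiv_genA (i : Fin 3) : swapEquiv q (genA q i) = genB q i := by
  simp [swapEquiv, OnsagerFamily.lift_genA]

omit hq0 hq in
theorem swapEquiv_genB (i : Fin 3) : swapEquiv q (genB q i) = genA q i := by
  simp [swapEquiv, OnsagerFamily.lift_genB]

omit hq0 hq in
theorem swapEquiv_lusztigFormula (X Y : SymOnsager q) :
    swapEquiv q (lusztigFormula q X Y) = lusztigFormula q (swapEquiv q X) (swapEquiv q Y) :=
  map_lusztigFormula (swapEquiv q : SymOnsager q →ₐ[F] SymOnsager q) q X Y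

omit hq0 hq in
theorem IsLusztigA.swap {i : Fin 3} {L : SymOnsager q ≃ₐ[F] SymOnsager q}
    (h : IsLusztigA q i L) : IsLusztigB q i (swapEquiv q * L * swapEquiv q) where
  map_B j := by simp [swapEquiv_genA, swapEquiv_genB, h.map_A]
  map_A_self := by simp [swapEquiv_genA, swapEquiv_genB, h.map_B_self]
  map_A j hj := by
    simp [swapEquiv_genA, swapEquiv_genB, h.map_B j hj, swapEquiv_lusztigFormula]

omit hq0 hq

theorem IsLusztigA.unique {i : Fin 3} {L M : SymOnsager q ≃ₐ[F] SymOnsager q}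
    (hL : IsLusztigA q i L) (hM : IsLusztigA q i M) : L = M := by
  apply SymOnsager.algEquiv_ext
  · intro j
    rw [hL.map_A, hM.map_A]
  · intro j
    rcases eq_or_ne j i with rfl | hj
    · rw [hL.map_B_self, hM.map_B_self]
    · rw [hL.map_B j hj, hM.map_B j hj]

theorem IsLusztigB.unique {i : Fin 3} {L M : SymOnsager q ≃ₐ[F] SymOnsager q}
    (hL : IsLusztigB q i L) (hM : IsLusztigB q i M) : L = M := by
  apply SymOnsager.algEquiv_ext
  · intro j
    rcases eq_or_ne j i with rfl | hj
    · rw [hL.map_A_self, hM.map_A_self]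
    · rw [hL.map_A j hj, hM.map_A j hj]
  · intro j
    rw [hL.map_B, hM.map_B]

theorem algEquiv_lusztigFormula (L : SymOnsager q ≃ₐ[F] SymOnsager q) (X Y : SymOnsager q) :
    L (lusztigFormula q X Y) = lusztigFormula q (L X) (L Y) :=
  map_lusztigFormula (L : SymOnsager q →ₐ[F] SymOnsager q) q X Y

theorem IsLusztigA.mul_comm {i j : Fin 3} (hij : i ≠ j) {L M : SymOnsager q ≃ₐ[F] SymOnsager q}
    (hL : IsLusztigA q i L) (hM : IsLusztigA q j M) : L * M = M * L := by
  apply SymOnsager.algEquiv_ext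
  · intro k
    simp [hL.map_A, hM.map_A]
  · intro k
    rcases eq_or_ne k i with rfl | hki
    · simp [hM.map_B k hij, hL.map_B_self, algEquiv_lusztigFormula, hL.map_A]
    · rcases eq_or_ne k j with rfl | hkj
      · simp [hM.map_B_self, hL.map_B k hki, algEquiv_lusztigFormula, hM.map_A]
      · simp [hM.map_B k hkj, hL.map_B k hki, algEquiv_lusztigFormula, hL.map_A, hM.map_A]
        exact lusztigFormula_comm q ((onsagerFamily_gen q).comm_left j i) _

theorem IsLusztigB.mul_comm {i j : Fin 3} (hij : i ≠ j) {L M : SymOnsager q ≃ₐ[F] SymOnsager q}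
    (hL : IsLusztigB q i L) (hM : IsLusztigB q j M) : L * M = M * L := by
  apply SymOnsager.algEquiv_ext
  · intro k
    rcases eq_or_ne k i with rfl | hki
    · simp [hM.map_A k hij, hL.map_A_self, algEquiv_lusztigFormula, hL.map_B]
    · rcases eq_or_ne k j with rfl | hkj
      · simp [hM.map_A_self, hL.map_A k hki, algEquiv_lusztigFormula, hM.map_B]
      · simp [hM.map_A k hkj, hL.map_A k hki, algEquiv_lusztigFormula, hL.map_B, hM.map_B]
        exact lusztigFormula_comm q ((onsagerFamily_gen q).comm_right j i) _
  · intro k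
    simp [hL.map_B, hM.map_B]

/-- On each generator at most one of the two maps acts nontrivially, and its value is an expression
in elements fixed by the other. -/
theorem IsLusztigA.mul_comm_isLusztigB {i : Fin 3} {L M : SymOnsager q ≃ₐ[F] SymOnsager q}
    (hL : IsLusztigA q i L) (hM : IsLusztigB q i M) : L * M = M * L := by
  apply SymOnsager.algEquiv_ext
  · intro k
    rcases eq_or_ne k i with rfl | hki
    · simp [hM.map_A_self, hL.map_A]
    · simp [hM.map_A k hki, hL.map_A, algEquiv_lusztigFormula, hL.map_B_self]
  · intro k
    rcases eq_or_ne k i with rfl | hki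
    · simp [hM.map_B, hL.map_B_self]
    · simp [hL.map_B k hki, hM.map_B, algEquiv_lusztigFormula, hM.map_A_self]

end Automorphisms

open scoped MatrixGroups Pointwise

/-! ### A free subgroup of SL(2, K) by ping-pong with a valuation -/

section PingPong

/-- The ping-pong lemma for two elements of a group in an arbitrary universe. -/
theorem injective_lift_of_ping_pong_pair {G α : Type*} [Group G] [MulAction G α] (a b : G)
    {X X' Y Y' : Set α} (hX0 : X.Nonempty) (hX0' : X'.Nonempty) (hXX : Disjoint X X')
    (hYY : Disjoint Y Y') (hXY : Disjoint X Y) (hXY' : Disjoint X Y') (hYX' : Disjoint Y X')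
    (hXY'' : Disjoint X' Y') (ha : ∀ g ∉ Y, a • g ∈ X) (hb : ∀ g ∉ Y', b • g ∈ X')
    (ha' : ∀ g ∉ X, a⁻¹ • g ∈ Y) (hb' : ∀ g ∉ X', b⁻¹ • g ∈ Y') :
    Function.Injective (FreeGroup.lift ![a, b]) := by
  have h := FreeGroup.injective_lift_of_ping_pong (fun i : ULift (Fin 2) => ![a, b] i.down)
    (fun i => ![X, X'] i.down) (fun i => ![Y, Y'] i.down) ?_ ?_ ?_ ?_ ?_ ?_
  · have e : FreeGroup.lift ![a, b] =
        (FreeGroup.lift (fun i : ULift (Fin 2) => ![a, b] i.down)).comp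
          (FreeGroup.freeGroupCongr Equiv.ulift.symm).toMonoidHom := by
      ext i
      simp
    rw [e]
    exact h.comp (FreeGroup.freeGroupCongr Equiv.ulift.symm).injective
  · rintro ⟨i⟩
    fin_cases i
    · exact hX0
    · exact hX0'
  · rintro ⟨i⟩ ⟨j⟩ hij
    fin_cases i <;> fin_cases j
    · exact absurd rfl hij
    · exact hXX
    · exact hXX.symm
    · exact absurd rfl hij
  · rintro ⟨i⟩ ⟨j⟩ hij
    fin_cases i <;> fin_cases j
    · exact absurd rfl hij
    · exact hYY
    · exact hYY.symm
    · exact absurd rfl hij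
  · rintro ⟨i⟩ ⟨j⟩
    fin_cases i <;> fin_cases j
    · exact hXY
    · exact hXY'
    · exact hYX'.symm
    · exact hXY''
  · rintro ⟨i⟩ _ ⟨g, hg, rfl⟩
    fin_cases i
    · exact ha g hg
    · exact hb g hg
  · rintro ⟨i⟩ _ ⟨g, hg, rfl⟩
    fin_cases i
    · exact ha' g hg
    · exact hb' g hg

variable {K Γ : Type*} [Field K] [LinearOrderedCommGroupWithZero Γ] (v : Valuation K Γ)

/-- The diagonal matrix with entries `s`, `s⁻¹`. -/
def diagonalSL (s : K) (hs : s ≠ 0) : SL(2, K) :=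
  ⟨!![s, 0; 0, s⁻¹], by simp [hs]⟩

/-- The matrix whose columns are `(1, p)` and `(1, p + 1)`. -/
def shearSL (p : K) : SL(2, K) :=
  ⟨!![1, 1; p, p + 1], by simp⟩

theorem coe_diagonalSL (s : K) (hs : s ≠ 0) :
    (diagonalSL s hs : Matrix (Fin 2) (Fin 2) K) = !![s, 0; 0, s⁻¹] := rfl

theorem coe_diagonalSL_inv (s : K) (hs : s ≠ 0) :
    ((diagonalSL s hs)⁻¹ : SL(2, K)).val = !![s⁻¹, 0; 0, s] := by
  rw [Matrix.SpecialLinearGroup.coe_inv, coe_diagonalSL, Matrix.adjugate_fin_two_of]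
  simp

theorem coe_shearSL (p : K) :
    (shearSL p : Matrix (Fin 2) (Fin 2) K) = !![1, 1; p, p + 1] := rfl

theorem coe_shearSL_inv (p : K) :
    ((shearSL p)⁻¹ : SL(2, K)).val = !![p + 1, -1; -p, 1] := by
  rw [Matrix.SpecialLinearGroup.coe_inv, coe_shearSL, Matrix.adjugate_fin_two_of]

/-- The matrices whose first column is dominated by its upper entry. -/
def dominatedUpper : Set SL(2, K) := {g | v (g 1 0) < v (g 0 0)}

/-- The matrices whose first column is dominated by its lower entry. -/
def dominatedLower : Set SL(2, K) := {g | v (g 0 0) < v (g 1 0)}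

theorem disjoint_dominatedUpper_dominatedLower :
    Disjoint (dominatedUpper v) (dominatedLower v) := by
  rw [Set.disjoint_left]
  intro g hg hg'
  exact lt_asymm hg hg'

theorem column_ne_zero (g : SL(2, K)) : g 0 0 ≠ 0 ∨ g 1 0 ≠ 0 := by
  by_contra! h
  have := g.det_coe
  rw [Matrix.det_fin_two, h.1, h.2] at this
  simp at this

variable {s : K} (hs0 : s ≠ 0) (hs : 1 < v s)

theorem diagonalSL_mul_apply (g : SL(2, K)) :
    (diagonalSL s hs0 * g) 0 0 = s * g 0 0 ∧ (diagonalSL s hs0 * g) 1 0 = s⁻¹ * g 1 0 := by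
  simp [Matrix.SpecialLinearGroup.coe_mul, coe_diagonalSL, Matrix.mul_apply]

theorem diagonalSL_inv_mul_apply (g : SL(2, K)) :
    ((diagonalSL s hs0)⁻¹ * g) 0 0 = s⁻¹ * g 0 0 ∧
      ((diagonalSL s hs0)⁻¹ * g) 1 0 = s * g 1 0 := by
  rw [Matrix.SpecialLinearGroup.coe_mul, coe_diagonalSL_inv]
  simp [Matrix.mul_apply]

theorem shearSL_mul_apply (p : K) (g : SL(2, K)) :
    (shearSL p * g) 0 0 = g 0 0 + g 1 0 ∧
      (shearSL p * g) 1 0 = p * g 0 0 + (p + 1) * g 1 0 := by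
  simp [Matrix.SpecialLinearGroup.coe_mul, coe_shearSL, Matrix.mul_apply]

include hs in
theorem valuation_inv_mul_lt {x y : K} (hx : x ≠ 0) (h : v y ≤ v x) : v (s⁻¹ * y) < v (s * x) := by
  rw [map_mul, map_mul, map_inv₀]
  have hx' : 0 < v x := by simpa [zero_lt_iff] using hx
  calc (v s)⁻¹ * v y ≤ 1 * v x := mul_le_mul' (inv_le_one_of_one_le₀ hs.le) h
    _ < v s * v x := by gcongr

include hs in
-- Multiplication by s and s⁻¹ turns the weak inequality into a strict one; the larger entry is
-- nonzero since the matrix is invertible.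
theorem diagonalSL_mul_mem {g : SL(2, K)} (hg : g ∉ dominatedLower v) :
    diagonalSL s hs0 * g ∈ dominatedUpper v := by
  have hle : v (g 1 0) ≤ v (g 0 0) := not_lt.1 hg
  have hx : g 0 0 ≠ 0 := by
    intro h0
    rw [h0, map_zero, le_zero_iff, map_eq_zero] at hle
    exact (column_ne_zero g).elim (· h0) (· hle)
  show v _ < v _
  rw [(diagonalSL_mul_apply hs0 g).1, (diagonalSL_mul_apply hs0 g).2]
  exact valuation_inv_mul_lt v hs hx hle

include hs in
theorem diagonalSL_inv_mul_mem {g : SL(2, K)} (hg : g ∉ dominatedUpper v) :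
    (diagonalSL s hs0)⁻¹ * g ∈ dominatedLower v := by
  have hle : v (g 0 0) ≤ v (g 1 0) := not_lt.1 hg
  have hx : g 1 0 ≠ 0 := by
    intro h0
    rw [h0, map_zero, le_zero_iff, map_eq_zero] at hle
    exact (column_ne_zero g).elim (· hle) (· h0)
  show v _ < v _
  rw [(diagonalSL_inv_mul_apply hs0 g).1, (diagonalSL_inv_mul_apply hs0 g).2]
  exact valuation_inv_mul_lt v hs hx hle

variable {p : K} (hp : v p = 1) (hpp : v (p + 1) = 1)

include hp hpp in
-- All entries of the shear have valuation 1, so the dominant entry of a column contributes equally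
-- to both entries of its image.
theorem valuation_shearSL_mul {g : SL(2, K)} (hg : g ∈ dominatedUpper v ∪ dominatedLower v) :
    v ((shearSL p * g) 0 0) = v ((shearSL p * g) 1 0) := by
  rw [(shearSL_mul_apply p g).1, (shearSL_mul_apply p g).2]
  rcases hg with hg | hg
  · have hg : v (g 1 0) < v (g 0 0) := hg
    rw [Valuation.map_add_eq_of_lt_left v hg,
      Valuation.map_add_eq_of_lt_left v (by simpa [hp, hpp] using hg), map_mul, hp, one_mul]
  · have hg : v (g 0 0) < v (g 1 0) := hg
    rw [Valuation.map_add_eq_of_lt_right v hg,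
      Valuation.map_add_eq_of_lt_right v (by simpa [hp, hpp] using hg), map_mul, hpp, one_mul]

include hp hpp in
-- The shear sends dominated columns to balanced ones, so its translates miss every dominated set.
theorem disjoint_dominated_shear {S T : Set SL(2, K)}
    (hS : S ⊆ dominatedUpper v ∪ dominatedLower v) (hT : T ⊆ dominatedUpper v ∪ dominatedLower v) :
    Disjoint S {g | (shearSL p)⁻¹ * g ∈ T} := by
  rw [Set.disjoint_left]
  intro g hg hg'
  have h := valuation_shearSL_mul v hp hpp (hT hg')
  rw [mul_inv_cancel_left] at h
  rcases hS hg with h' | h'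
  · exact h'.ne' h
  · exact h'.ne h

include hs hp hpp in
/-- A diagonal matrix with an entry of valuation greater than `1` and a conjugate of it in general
position generate a free group. -/
theorem injective_lift_diagonalSL_conj : Function.Injective
    (FreeGroup.lift ![diagonalSL s hs0, shearSL p * diagonalSL s hs0 * (shearSL p)⁻¹]) := by
  have hd := disjoint_dominatedUpper_dominatedLower v
  have hU : dominatedUpper v ⊆ dominatedUpper v ∪ dominatedLower v := Set.subset_union_left
  have hL : dominatedLower v ⊆ dominatedUpper v ∪ dominatedLower v := Set.subset_union_right
  have h1 : (1 : SL(2, K)) ∈ dominatedUpper v := by simp [dominatedUpper]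
  have h1' : shearSL p ∈ {g | (shearSL p)⁻¹ * g ∈ dominatedUpper v} := by
    rw [Set.mem_ofPred_eq, inv_mul_cancel]
    exact h1
  -- The group acts on itself by left multiplication. The sets for the first generator are the two
  -- dominated sets, those for the second are their translates by the shear.
  refine injective_lift_of_ping_pong_pair _ _ ⟨1, h1⟩ ⟨_, h1'⟩
    (disjoint_dominated_shear v hp hpp hU hU) (disjoint_dominated_shear v hp hpp hL hL)
    hd (disjoint_dominated_shear v hp hpp hU hL) (disjoint_dominated_shear v hp hpp hL hU)
    (hd.preimage (fun g => (shearSL p)⁻¹ * g))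
    (fun g hg => diagonalSL_mul_mem v hs0 hs hg) (fun g hg => ?_)
    (fun g hg => diagonalSL_inv_mul_mem v hs0 hs hg) (fun g hg => ?_)
  · rw [Set.mem_ofPred_eq] at hg ⊢
    rw [smul_eq_mul, mul_assoc, mul_assoc, inv_mul_cancel_left]
    exact diagonalSL_mul_mem v hs0 hs hg
  · rw [Set.mem_ofPred_eq] at hg ⊢
    rw [smul_eq_mul, mul_inv_rev, mul_inv_rev, inv_inv, mul_assoc, inv_mul_cancel_left, mul_assoc]
    exact diagonalSL_inv_mul_mem v hs0 hs hg

end PingPong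

/-! ### The Lusztig formula for a diagonal 2×2 matrix is a conjugation -/

section Representation

variable {F K : Type*} [Field F] [Field K] [Algebra F K]

/-- Multiplying by a diagonal matrix scales rows on the left and columns on the right. -/
theorem sandwich_diagonal {n : Type*} [Fintype n] [DecidableEq n] (d : n → K) (M : Matrix n n K)
    (p : MvPolynomial (Fin 2) F) (i j : n) :
    sandwich (Matrix.diagonal d) M p i j = MvPolynomial.aeval ![d i, d j] p * M i j := by
  induction p using MvPolynomial.induction_on' with
  | add p r hp hr => rw [map_add, map_add, Matrix.add_apply, hp, hr, add_mul]
  | monomial m c =>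
    rw [sandwich_monomial, MvPolynomial.aeval_monomial, Matrix.smul_apply, Matrix.diagonal_pow,
      Matrix.diagonal_pow, Matrix.mul_diagonal, Matrix.diagonal_mul,
      Finsupp.prod_fintype _ _ (by simp), Fin.prod_univ_two, Algebra.smul_def]
    simp
    ring

/-- Conjugation by an element of `SL(2, K)`. -/
noncomputable def conjAlgHom (F : Type*) [Field F] [Algebra F K] (g : SL(2, K)) :
    Matrix (Fin 2) (Fin 2) K →ₐ[F] Matrix (Fin 2) (Fin 2) K :=
  AlgHom.ofLinearMap
    { toFun M := g * M * (g⁻¹ : SL(2, K))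
      map_add' M N := by rw [mul_add, add_mul]
      map_smul' c M := by simp }
    (by
      show g.val * 1 * (g⁻¹ : SL(2, K)).val = 1
      rw [mul_one, ← Matrix.SpecialLinearGroup.coe_mul, mul_inv_cancel,
        Matrix.SpecialLinearGroup.coe_one])
    (fun M N => by
      have h : (g⁻¹ : SL(2, K)).val * g.val = 1 := by
        rw [← Matrix.SpecialLinearGroup.coe_mul, inv_mul_cancel, Matrix.SpecialLinearGroup.coe_one]
      show g.val * (M * N) * (g⁻¹ : SL(2, K)).val =
        g.val * M * (g⁻¹ : SL(2, K)).val * (g.val * N * (g⁻¹ : SL(2, K)).val)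
      calc _ = g.val * M * 1 * N * (g⁻¹ : SL(2, K)).val := by noncomm_ring
        _ = _ := by rw [← h]; noncomm_ring)

theorem conjAlgHom_apply (g : SL(2, K)) (M : Matrix (Fin 2) (Fin 2) K) :
    conjAlgHom F g M = g.val * M * (g⁻¹ : SL(2, K)).val := rfl

theorem conjAlgHom_mul (g h : SL(2, K)) (M : Matrix (Fin 2) (Fin 2) K) :
    conjAlgHom F (g * h) M = conjAlgHom F g (conjAlgHom F h M) := by
  simp [conjAlgHom_apply, mul_inv_rev, Matrix.SpecialLinearGroup.coe_mul, mul_assoc]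

theorem conjAlgHom_one (M : Matrix (Fin 2) (Fin 2) K) : conjAlgHom F 1 M = M := by
  simp [conjAlgHom_apply]

theorem conjAlgHom_inv_apply (g : SL(2, K)) (M : Matrix (Fin 2) (Fin 2) K) :
    conjAlgHom F g (conjAlgHom F g⁻¹ M) = M := by
  rw [← conjAlgHom_mul, mul_inv_cancel, conjAlgHom_one]

theorem conjAlgHom_apply_inv (g : SL(2, K)) (M : Matrix (Fin 2) (Fin 2) K) :
    conjAlgHom F g⁻¹ (conjAlgHom F g M) = M := by
  rw [← conjAlgHom_mul, inv_mul_cancel, conjAlgHom_one]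

/-- The eigenvalues `qs + (qs)⁻¹` and `q⁻¹s + qs⁻¹`. -/
def eigenvalues (q s : K) : Fin 2 → K := ![q * s + q⁻¹ * s⁻¹, q⁻¹ * s + q * s⁻¹]

/-- The eigenvalues have the form u + u⁻¹ with u = qs and u = q⁻¹s. The ratio q² of these parameters
makes the quadratic factor vanish. -/
theorem dolanGradyPoly_eigenvalues {q s : K} (hq : q ≠ 0) (hs : s ≠ 0) (i j : Fin 2) :
    dolanGradyPoly q q⁻¹ (eigenvalues q s i) (eigenvalues q s j) = 0 := by
  fin_cases i <;> fin_cases j <;> simp [dolanGradyPoly, eigenvalues] <;> right <;> field_simp <;>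
    ring

/-- These values are the factors by which conjugation by diag(s, s⁻¹) scales the matrix entries. -/
theorem lusztigPoly_eigenvalues {q s k : K} (hq : q ≠ 0) (hs : s ≠ 0)
    (hk : k * ((q - q⁻¹) * (q ^ 2 - q⁻¹ ^ 2)) = 1) :
    lusztigPoly q q⁻¹ k (eigenvalues q s 0) (eigenvalues q s 1) = s ^ 2 ∧
    lusztigPoly q q⁻¹ k (eigenvalues q s 1) (eigenvalues q s 0) = s⁻¹ ^ 2 ∧
    ∀ i, lusztigPoly q q⁻¹ k (eigenvalues q s i) (eigenvalues q s i) = 1 := by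
  have h (x y : K) : lusztigPoly q q⁻¹ k x y =
      k * ((q - q⁻¹) * (q ^ 2 - q⁻¹ ^ 2) + (x - y) * (q * x - q⁻¹ * y)) := by
    rw [mul_add, hk, lusztigPoly]
  have h1 : (q - q⁻¹) * (q ^ 2 - q⁻¹ ^ 2) + (eigenvalues q s 0 - eigenvalues q s 1) *
      (q * eigenvalues q s 0 - q⁻¹ * eigenvalues q s 1) =
      (q - q⁻¹) * (q ^ 2 - q⁻¹ ^ 2) * s ^ 2 := by
    simp [eigenvalues]
    field_simp
    ring
  have h2 : (q - q⁻¹) * (q ^ 2 - q⁻¹ ^ 2) + (eigenvalues q s 1 - eigenvalues q s 0) *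
      (q * eigenvalues q s 1 - q⁻¹ * eigenvalues q s 0) =
      (q - q⁻¹) * (q ^ 2 - q⁻¹ ^ 2) * s⁻¹ ^ 2 := by
    simp [eigenvalues]
    field_simp
    ring
  refine ⟨?_, ?_, fun i => ?_⟩
  · rw [h, h1, ← mul_assoc, hk, one_mul]
  · rw [h, h2, ← mul_assoc, hk, one_mul]
  · simp [lusztigPoly]

variable {q : F} (hq0 : q ≠ 0) (hq : ∀ n : ℕ, 0 < n → q ^ n ≠ 1) {s : K} (hs : s ≠ 0)

include hq0 hq hs

theorem dolanGrady_diagonal (M : Matrix (Fin 2) (Fin 2) K) :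
    DolanGrady q (Matrix.diagonal (eigenvalues (algebraMap F K q) s)) M := by
  rw [dolanGrady_iff hq0 hq]
  ext i j
  rw [sandwich_diagonal, ← AlgHom.coe_toRingHom, map_dolanGradyPoly]
  simp only [AlgHom.coe_toRingHom, MvPolynomial.aeval_X, MvPolynomial.aeval_C, map_inv₀]
  have := dolanGradyPoly_eigenvalues ((map_ne_zero (algebraMap F K)).2 hq0) hs i j
  simp [this]

theorem lusztigFormula_diagonal (M : Matrix (Fin 2) (Fin 2) K) :
    lusztigFormula q (Matrix.diagonal (eigenvalues (algebraMap F K q) s)) M =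
      conjAlgHom F (diagonalSL s hs) M := by
  have hs' {n : ℕ} (hn : 0 < n) := sub_inv_ne_zero_of_pow_ne_one hq0 hq hn
  have hs1 : q - q⁻¹ ≠ 0 := by simpa using hs' one_pos
  have hk := congrArg (algebraMap F K) (inv_mul_cancel₀ (mul_ne_zero hs1 (hs' two_pos)))
  rw [map_mul, map_mul, map_sub, map_sub, map_pow, map_pow, map_inv₀ (algebraMap F K) q,
    map_one] at hk
  obtain ⟨h1, h2, h3⟩ := lusztigPoly_eigenvalues ((map_ne_zero (algebraMap F K)).2 hq0) hs hk
  rw [← sandwich_lusztigMvPoly, conjAlgHom_apply, coe_diagonalSL, coe_diagonalSL_inv]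
  ext i j
  rw [sandwich_diagonal, lusztigMvPoly, ← AlgHom.coe_toRingHom, map_lusztigPoly]
  simp only [AlgHom.coe_toRingHom, MvPolynomial.aeval_X, MvPolynomial.aeval_C,
    map_inv₀ (algebraMap F K) q]
  generalize algebraMap F K (((q - q⁻¹) * (q ^ 2 - q⁻¹ ^ 2))⁻¹) = k at *
  fin_cases i <;> fin_cases j <;>
    simp [h1, h2, h3, Matrix.mul_apply, Fin.sum_univ_two, Matrix.vecMul, dotProduct] <;> field_simp

end Representation

/-! ### Freeness of the subgroup generated by L_i and L_j^* -/

section Freeness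

variable {F : Type*} [Field F]

section DegenerateArguments

variable {R : Type*} [Ring R] [Algebra F R]

theorem dolanGrady_zero_left (q : F) (X : R) : DolanGrady q 0 X := by
  simp [DolanGrady, dolanGradyLHS, dolanGradyRHS]

theorem lusztigFormula_self (q : F) (X : R) : lusztigFormula q X X = X := by
  have := lusztigFormula_one (q := q) X
  rw [← sandwich_lusztigMvPoly] at this ⊢
  nth_rewrite 2 [← mul_one X]
  rw [sandwich_mul_left_of_commute _ _ (Commute.refl X), this, mul_one]

theorem commute_single_single {ι : Type*} [DecidableEq ι] (i k l : ι) (X : R) :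
    Commute ((Pi.single i X : ι → R) k) ((Pi.single i X : ι → R) l) := by
  rcases eq_or_ne k i with rfl | hk
  · rcases eq_or_ne l k with rfl | hl
    · exact Commute.refl _
    · rw [Pi.single_eq_of_ne hl]
      exact Commute.zero_right _
  · rw [Pi.single_eq_of_ne hk]
    exact Commute.zero_left _

theorem dolanGrady_single {ι : Type*} [DecidableEq ι] {q : F} {X : R}
    (h : ∀ Y, DolanGrady q X Y) (i k : ι) (Y : R) :
    DolanGrady q ((Pi.single i X : ι → R) k) Y := by
  rcases eq_or_ne k i with rfl | hk
  · rw [Pi.single_eq_same]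
    exact h Y
  · rw [Pi.single_eq_of_ne hk]
    exact dolanGrady_zero_left q Y

end DegenerateArguments

variable {K : Type*} [Field K] [Algebra F K]

theorem apply_eq_zero_of_conj_diagonal {d : Fin 2 → K} (hd : d 0 ≠ d 1) {g : SL(2, K)}
    (h : conjAlgHom F g (Matrix.diagonal d) = Matrix.diagonal d) : g 0 1 = 0 ∧ g 1 0 = 0 := by
  have h' : g.val * Matrix.diagonal d = Matrix.diagonal d * g.val := by
    have e := congrArg (· * g.val) h
    simp only [conjAlgHom_apply, mul_assoc] at e
    rwa [← Matrix.SpecialLinearGroup.coe_mul, inv_mul_cancel, Matrix.SpecialLinearGroup.coe_one,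
      mul_one] at e
  constructor
  · have e := congrFun (congrFun h' 0) 1
    rw [Matrix.mul_diagonal, Matrix.diagonal_mul, mul_comm, ← sub_eq_zero, ← sub_mul] at e
    exact (mul_eq_zero.1 e).resolve_left (sub_ne_zero.2 hd.symm)
  · have e := congrFun (congrFun h' 1) 0
    rw [Matrix.mul_diagonal, Matrix.diagonal_mul, mul_comm, ← sub_eq_zero, ← sub_mul] at e
    exact (mul_eq_zero.1 e).resolve_left (sub_ne_zero.2 hd)

/-- Commuting with the first matrix makes g diagonal, and commuting with its sheared conjugate makes
g scalar. A scalar matrix of determinant 1 squares to 1. -/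
theorem mul_self_eq_one_of_conj {d : Fin 2 → K} (hd : d 0 ≠ d 1) {p : K} (hp : p + 1 ≠ 0)
    {g : SL(2, K)} (h : conjAlgHom F g (Matrix.diagonal d) = Matrix.diagonal d)
    (h' : conjAlgHom F g (conjAlgHom F (shearSL p) (Matrix.diagonal d)) =
      conjAlgHom F (shearSL p) (Matrix.diagonal d)) : g * g = 1 := by
  obtain ⟨h01, h10⟩ := apply_eq_zero_of_conj_diagonal hd h
  have h2 : conjAlgHom F ((shearSL p)⁻¹ * (g * shearSL p)) (Matrix.diagonal d) =
      Matrix.diagonal d := by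
    rw [conjAlgHom_mul, conjAlgHom_mul, h', conjAlgHom_apply_inv]
  have e := (apply_eq_zero_of_conj_diagonal hd h2).1
  rw [Matrix.SpecialLinearGroup.coe_mul, Matrix.SpecialLinearGroup.coe_mul, coe_shearSL_inv,
    coe_shearSL] at e
  simp only [Matrix.mul_apply, Fin.sum_univ_two, h01, h10] at e
  -- This is the upper right entry of the conjugate of the diagonal matrix g by the inverse shear.
  have e1 : (p + 1) * (g 0 0 - g 1 1) = 0 := by
    rw [← e]
    simp
    ring
  have e2 : g 0 0 = g 1 1 := sub_eq_zero.1 ((mul_eq_zero.1 e1).resolve_left hp)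
  have hdet := g.det_coe
  rw [Matrix.det_fin_two, h01, zero_mul, sub_zero] at hdet
  apply Matrix.SpecialLinearGroup.ext
  intro i j
  rw [Matrix.SpecialLinearGroup.coe_mul, Matrix.SpecialLinearGroup.coe_one, Matrix.mul_apply,
    Fin.sum_univ_two]
  fin_cases i <;> fin_cases j
  · simpa [h01, e2] using hdet
  · simp [h01]
  · simp [h10]
  · simpa [h10, e2] using hdet

variable {q : F} (hq0 : q ≠ 0) (hq : ∀ n : ℕ, 0 < n → q ^ n ≠ 1) {s : K} (hs : s ≠ 0)

include hq0 hq hs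

theorem dolanGrady_conj_diagonal (g : SL(2, K)) (M : Matrix (Fin 2) (Fin 2) K) :
    DolanGrady q (conjAlgHom F g (Matrix.diagonal (eigenvalues (algebraMap F K q) s))) M := by
  have := (dolanGrady_diagonal hq0 hq hs (conjAlgHom F g⁻¹ M)).map (conjAlgHom F g)
  rwa [conjAlgHom_inv_apply] at this

theorem lusztigFormula_conj_diagonal (g : SL(2, K)) (M : Matrix (Fin 2) (Fin 2) K) :
    lusztigFormula q (conjAlgHom F g (Matrix.diagonal (eigenvalues (algebraMap F K q) s))) M =
      conjAlgHom F (g * diagonalSL s hs * g⁻¹) M := by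
  have := map_lusztigFormula (conjAlgHom F g) q
    (Matrix.diagonal (eigenvalues (algebraMap F K q) s)) (conjAlgHom F g⁻¹ M)
  rw [conjAlgHom_inv_apply, lusztigFormula_diagonal hq0 hq hs] at this
  rw [← this, conjAlgHom_mul, conjAlgHom_mul]

/-- Only A_i and B_j are nonzero and i ≠ j, so every required commutation is trivial. The chosen
eigenvalues give the Dolan/Grady relation with every matrix. -/
theorem onsagerFamily_diagonal {i j : Fin 3} (hij : i ≠ j) (g : SL(2, K)) :
    OnsagerFamily q
      (Pi.single i (Matrix.diagonal (eigenvalues (algebraMap F K q) s)) : Fin 3 → _)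
      (Pi.single j (conjAlgHom F g
        (Matrix.diagonal (eigenvalues (algebraMap F K q) s))) : Fin 3 → _) := by
  constructor
  · exact fun k l => commute_single_single _ _ _ _
  · exact fun k l => commute_single_single _ _ _ _
  · intro k
    rcases eq_or_ne k i with rfl | h
    · rw [Pi.single_eq_of_ne hij]
      exact Commute.zero_right _
    · rw [Pi.single_eq_of_ne h]
      exact Commute.zero_left _
  · exact fun k l _ => dolanGrady_single (dolanGrady_diagonal hq0 hq hs) _ _ _
  · exact fun k l _ => dolanGrady_single (dolanGrady_conj_diagonal hq0 hq hs g) _ _ _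

theorem conj_diagonalSL_diagonal :
    conjAlgHom F (diagonalSL s hs) (Matrix.diagonal (eigenvalues (algebraMap F K q) s)) =
      Matrix.diagonal (eigenvalues (algebraMap F K q) s) := by
  rw [← lusztigFormula_diagonal hq0 hq hs, lusztigFormula_self]

theorem lift_isLusztigA {i j : Fin 3} (hij : i ≠ j) (g : SL(2, K))
    {L : SymOnsager q ≃ₐ[F] SymOnsager q} (hL : IsLusztigA q i L) (x : SymOnsager q) :
    (onsagerFamily_diagonal hq0 hq hs hij g).lift (L x) =
      conjAlgHom F (diagonalSL s hs) ((onsagerFamily_diagonal hq0 hq hs hij g).lift x) := by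
  suffices h : (onsagerFamily_diagonal hq0 hq hs hij g).lift.comp L.toAlgHom =
      (conjAlgHom F (diagonalSL s hs)).comp (onsagerFamily_diagonal hq0 hq hs hij g).lift from
    DFunLike.congr_fun h x
  apply SymOnsager.algHom_ext
  · intro k
    show OnsagerFamily.lift _ (L _) = conjAlgHom F _ (OnsagerFamily.lift _ _)
    rw [hL.map_A, OnsagerFamily.lift_genA]
    rcases eq_or_ne k i with rfl | h
    · rw [Pi.single_eq_same, conj_diagonalSL_diagonal hq0 hq hs]
    · rw [Pi.single_eq_of_ne h, map_zero]
  · intro k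
    show OnsagerFamily.lift _ (L _) = conjAlgHom F _ (OnsagerFamily.lift _ _)
    rcases eq_or_ne k i with rfl | h
    · rw [hL.map_B_self, OnsagerFamily.lift_genB, Pi.single_eq_of_ne hij, map_zero]
    · rw [hL.map_B k h, map_lusztigFormula, OnsagerFamily.lift_genB, OnsagerFamily.lift_genA,
        Pi.single_eq_same, lusztigFormula_diagonal hq0 hq hs]

theorem lift_isLusztigB {i j : Fin 3} (hij : i ≠ j) (g : SL(2, K))
    {L : SymOnsager q ≃ₐ[F] SymOnsager q} (hL : IsLusztigB q j L) (x : SymOnsager q) :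
    (onsagerFamily_diagonal hq0 hq hs hij g).lift (L x) =
      conjAlgHom F (g * diagonalSL s hs * g⁻¹)
        ((onsagerFamily_diagonal hq0 hq hs hij g).lift x) := by
  suffices h : (onsagerFamily_diagonal hq0 hq hs hij g).lift.comp L.toAlgHom =
      (conjAlgHom F (g * diagonalSL s hs * g⁻¹)).comp
        (onsagerFamily_diagonal hq0 hq hs hij g).lift from
    DFunLike.congr_fun h x
  apply SymOnsager.algHom_ext
  · intro k
    show OnsagerFamily.lift _ (L _) = conjAlgHom F _ (OnsagerFamily.lift _ _)
    rcases eq_or_ne k j with rfl | h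
    · rw [hL.map_A_self, OnsagerFamily.lift_genA, Pi.single_eq_of_ne hij.symm, map_zero]
    · rw [hL.map_A k h, map_lusztigFormula, OnsagerFamily.lift_genB, OnsagerFamily.lift_genA,
        Pi.single_eq_same, lusztigFormula_conj_diagonal hq0 hq hs]
  · intro k
    show OnsagerFamily.lift _ (L _) = conjAlgHom F _ (OnsagerFamily.lift _ _)
    rw [hL.map_B, OnsagerFamily.lift_genB]
    rcases eq_or_ne k j with rfl | h
    · rw [Pi.single_eq_same, conjAlgHom_mul, conjAlgHom_mul, conjAlgHom_apply_inv,
        conj_diagonalSL_diagonal hq0 hq hs]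
    · rw [Pi.single_eq_of_ne h, map_zero]

/-- The representation intertwines each word in L_i, L_j^* with conjugation by the same word in
SL(2, K). -/
theorem lift_freeGroup_lift {i j : Fin 3} (hij : i ≠ j) (g : SL(2, K))
    {L M : SymOnsager q ≃ₐ[F] SymOnsager q} (hL : IsLusztigA q i L) (hM : IsLusztigB q j M)
    (w : FreeGroup (Fin 2)) (x : SymOnsager q) :
    (onsagerFamily_diagonal hq0 hq hs hij g).lift (FreeGroup.lift ![L, M] w x) =
      conjAlgHom F (FreeGroup.lift ![diagonalSL s hs, g * diagonalSL s hs * g⁻¹] w)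
        ((onsagerFamily_diagonal hq0 hq hs hij g).lift x) := by
  have hof (k : Fin 2) (x : SymOnsager q) :
      (onsagerFamily_diagonal hq0 hq hs hij g).lift (![L, M] k x) =
      conjAlgHom F (![diagonalSL s hs, g * diagonalSL s hs * g⁻¹] k)
        ((onsagerFamily_diagonal hq0 hq hs hij g).lift x) := by
    fin_cases k
    · exact lift_isLusztigA hq0 hq hs hij g hL x
    · exact lift_isLusztigB hq0 hq hs hij g hM x
  induction w using FreeGroup.induction_on generalizing x with
  | C1 => rw [map_one, map_one, conjAlgHom_one, AlgEquiv.one_apply]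
  | of k => rw [FreeGroup.lift_apply_of, FreeGroup.lift_apply_of, hof]
  | inv_of k _ =>
    rw [map_inv, map_inv, FreeGroup.lift_apply_of, FreeGroup.lift_apply_of]
    have h := hof k ((![L, M] k)⁻¹ x)
    rw [← AlgEquiv.mul_apply, mul_inv_cancel, AlgEquiv.one_apply] at h
    rw [h, conjAlgHom_apply_inv]
  | mul v w hv hw => rw [map_mul, map_mul, AlgEquiv.mul_apply, hv, hw, conjAlgHom_mul]

omit hs in
theorem injective_lift_lusztig {i j : Fin 3} (hij : i ≠ j)
    {L M : SymOnsager q ≃ₐ[F] SymOnsager q} (hL : IsLusztigA q i L) (hM : IsLusztigB q j M) :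
    Function.Injective (FreeGroup.lift ![L, M]) := by
  classical
  have hs : (RatFunc.X : RatFunc F) ≠ 0 := RatFunc.X_ne_zero
  -- The parameter s is the variable of F(X), which is large at infinity, while nonzero constants
  -- have valuation 1. So p = q serves as shear parameter, since q ≠ 0 and q ≠ -1.
  have hvs : 1 < RatFunc.inftyValuation F RatFunc.X := by
    rw [RatFunc.inftyValuation.X, ← WithZero.exp_zero, WithZero.exp_lt_exp]
    exact one_pos
  have hq1 : q + 1 ≠ 0 := by
    intro h
    apply hq 2 two_pos
    rw [eq_neg_of_add_eq_zero_left h]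
    ring
  have hp : RatFunc.inftyValuation F (algebraMap F (RatFunc F) q) = 1 :=
    RatFunc.inftyValuation.C F hq0
  have hp' : RatFunc.inftyValuation F (algebraMap F (RatFunc F) q + 1) = 1 := by
    rw [← map_one (algebraMap F (RatFunc F)), ← map_add]
    exact RatFunc.inftyValuation.C F hq1
  -- The difference of the two eigenvalues is (q - q⁻¹)(X - X⁻¹).
  have hd : eigenvalues (algebraMap F (RatFunc F) q) RatFunc.X 0 ≠
      eigenvalues (algebraMap F (RatFunc F) q) RatFunc.X 1 := by
    have hqq : algebraMap F (RatFunc F) q - (algebraMap F (RatFunc F) q)⁻¹ ≠ 0 := by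
      rw [← map_inv₀, ← map_sub, Ne, map_eq_zero]
      simpa using sub_inv_ne_zero_of_pow_ne_one hq0 hq one_pos
    have hss : (RatFunc.X : RatFunc F) - RatFunc.X⁻¹ ≠ 0 := by
      intro h
      have := congrArg (RatFunc.inftyValuation F) (sub_eq_zero.1 h)
      rw [map_inv₀] at this
      exact (this.symm ▸ hvs).not_ge (inv_le_one_of_one_le₀ hvs.le)
    intro h
    apply mul_ne_zero hqq hss
    simp only [eigenvalues, Matrix.cons_val_zero, Matrix.cons_val_one] at h
    linear_combination h
  rw [injective_iff_map_eq_one]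
  intro w hw
  have key := lift_freeGroup_lift hq0 hq hs hij (shearSL (algebraMap F (RatFunc F) q)) hL hM w
  simp only [hw, AlgEquiv.one_apply] at key
  have hA := key (genA q i)
  have hB := key (genB q j)
  rw [OnsagerFamily.lift_genA, Pi.single_eq_same] at hA
  rw [OnsagerFamily.lift_genB, Pi.single_eq_same] at hB
  -- Conjugation sees matrices only up to sign, so only the square of the image of w is known to be
  -- 1. Torsion-freeness of the free group then gives w = 1.
  have hg := mul_self_eq_one_of_conj hd
    (by rw [← map_one (algebraMap F (RatFunc F)), ← map_add, Ne, map_eq_zero]; exact hq1)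
    hA.symm hB.symm
  rw [← map_mul, ← sq] at hg
  have := (injective_iff_map_eq_one _).1
    (injective_lift_diagonalSL_conj (RatFunc.inftyValuation F) hs hvs hp hp') _ hg
  exact (pow_eq_one_iff_left two_ne_zero).1 this

end Freeness

/-- The six Lusztig automorphisms of `𝕆_q` exist, are uniquely determined by their action on the
standard generators, and are related as stated. The group structure on
`SymOnsager q ≃ₐ[F] SymOnsager q` is composition; the last clause says that the canonical
homomorphism from the free group on two letters sending the letters to `L_i` and `L*_j` is
injective, i.e. that `L_i^{±1}, (L*_j)^{±1}` freely generate a subgroup. -/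
theorem theorem5p6 {F : Type*} [Field F] (q : F) (hq0 : q ≠ 0)
    (hq : ∀ n : ℕ, 0 < n → q ^ n ≠ 1) :
    (∀ i : Fin 3, ∃! L : SymOnsager q ≃ₐ[F] SymOnsager q, IsLusztigA q i L) ∧
    (∀ i : Fin 3, ∃! L : SymOnsager q ≃ₐ[F] SymOnsager q, IsLusztigB q i L) ∧
    ∀ L Ls : Fin 3 → (SymOnsager q ≃ₐ[F] SymOnsager q),
      (∀ i, IsLusztigA q i (L i)) → (∀ i, IsLusztigB q i (Ls i)) →
      (∀ i j : Fin 3, i ≠ j → L i * L j = L j * L i ∧ Ls i * Ls j = Ls j * Ls i) ∧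
      (∀ i : Fin 3, L i * Ls i = Ls i * L i) ∧
      (∀ i j : Fin 3, i ≠ j →
        Function.Injective (FreeGroup.lift ![L i, Ls j] :
          FreeGroup (Fin 2) →* (SymOnsager q ≃ₐ[F] SymOnsager q))) := by

  refine ⟨fun i => ?_, fun i => ?_, fun L Ls hL hLs => ⟨fun i j hij => ?_, fun i => ?_,
    fun i j hij => ?_⟩⟩
  · obtain ⟨L, hL⟩ := exists_isLusztigA hq0 hq i
    exact ⟨L, hL, fun M hM => hM.unique hL⟩
  · obtain ⟨L, hL⟩ := exists_isLusztigA hq0 hq i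
    exact ⟨_, hL.swap, fun M hM => hM.unique hL.swap⟩
  · exact ⟨(hL i).mul_comm hij (hL j), (hLs i).mul_comm hij (hLs j)⟩
  · exact (hL i).mul_comm_isLusztigB (hLs i)
  · exact injective_lift_lusztig hq0 hq hij (hL i) (hLs j)
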